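/- Let $V=\mathbb{C}^2\otimes\mathbb{C}^3\otimes\mathbb{C}^3$, with the action of $G=\mathrm{GL}_2\times\mathrm{GL}_3\times\mathrm{GL}_3$, and write a tensor $\mathbf e_1\otimes M+\mathbf e_2\otimes N$ as the pencil of $3\times 3$ matrices $uM+vN$. Let $\mathcal{O}_{n}=G\cdot T_n$, where $$T_{13}=\begin{pmatrix}u&v&0\\0&0&u\\0&0&v\end{pmatrix},\quad T_{14}=\begin{pmatrix}u&0&0\\0&u&0\\0&0&v\end{pmatrix},\quad T_{15}=\begin{pmatrix}u&v&0\\0&u&0\\0&0&u\end{pmatrix},\quad T_{16}=\begin{pmatrix}u&v&0\\0&u&v\\0&0&u\end{pmatrix},\quad T_{17}=\begin{pmatrix}u&v&0\\0&u&0\\0&0&v\end{pmatrix}.$$ The forbidden locus $\mathcal{F}_T$ of $T\in V$ is the complement in $\mathbb{C}^2\times\mathbb{C}^3\times\mathbb{C}^3$ of the decomposition locus $\mathcal D_T$, the set of all $(\mathbf a,\mathbf b,\mathbf c)$ such that $\mathrm{rk}(T-\lambda\,\mathbf a\otimes\mathbf b\otimes\mathbf c)=\mathrm{rk}(T)-1$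 for some $\lambda\in\mathbb{C}$, where $\mathrm{rk}$ is tensor rank. Let $X_{233}\subset\mathbb{P}(V)$ and $X_{33}\subset\mathbb{P}(\mathbb{C}^3\otimes\mathbb{C}^3)$ be the Segre varieties; $\sigma_2(X)$ the Zariski closure of the set of points of rank at most $2$; $\mathcal{X}_{233}^\vee\subset\mathbb{P}(V)$ the dual variety of the Segre variety in $\mathbb{P}(V^\vee)$; $\mathrm{Sub}_{m_1m_2m_3}\subset\mathbb{P}(V)$ the set of the $[T]$ with $T\in A'\otimes B'\otimes C'$ for some subspaces $A'\subseteq\mathbb{C}^2$, $B',C'\subseteq\mathbb{C}^3$ of dimensions $m_1,m_2,m_3$; and $J^\circ=J^\circ(X_{233},\mathbb{P}^1\times\sigma_2(X_{33}))$ the union of all lines joining a point of $X_{233}$ to a distinct point of $\mathbb{P}^1\times\sigma_2(X_{33})=\{[\mathbf a\otimes M] : \mathbf a\ne 0,\ [M]\in\sigma_2(X_{33})\}$. Then, for every $T\in\mathcal{O}_{13}\cup\mathcal{O}_{15}\cup\mathcal{O}_{16}\cup\mathcal{O}_{17}$, the forbidden locus $\mathcal{F}_T$ is the set of all $(\mathbf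 a,\mathbf b,\mathbf c)\in\mathbb{C}^2\times\mathbb{C}^3\times\mathbb{C}^3$ such that, with $P=\mathbf a\otimes\mathbf b\otimes\mathbf c$, for every $\lambda\in\mathbb{C}$ one has $T-\lambda P\neq 0$ and $$[T-\lambda P]\in\mathcal{X}_{233}^\vee\smallsetminus\bigl(\sigma_2(X_{233})\cup\mathrm{Sub}_{223}\cup\mathrm{Sub}_{232}\cup J^\circ\bigr).$$ Moreover, the Zariski closure of $J^\circ$, i.e. the join variety $J(X_{233},\mathbb{P}^1\times\sigma_2(X_{33}))$, is equal to the Zariski closure of the set of the $[S]$ with $S\in\mathcal{O}_{14}$. -/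

import Mathlib

open scoped TensorProduct LinearAlgebra.Projectivization

namespace TensorLoci

section Projective

variable {V : Type*} [AddCommGroup V] [Module ℂ V]

/-- The value at `v` of the polynomial function on `V` given by a polynomial `f` in the linear forms
on `V`. For finite-dimensional `V` these are exactly the polynomial functions on `V`. -/
noncomputable def polyEval (f : MvPolynomial (Module.Dual ℂ V) ℂ) (v : V) : ℂ :=
  MvPolynomial.eval (fun φ : Module.Dual ℂ V => φ v) f

/-- The Zariski closure of a subset of the projective space `ℙ(V)`: the common zeros of all
homogeneous polynomials that vanish on the subset. -/
def zariskiClosure (S : Set (ℙ ℂ V)) : Set (ℙ ℂ V) :=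
  {p | ∀ (d : ℕ) (f : MvPolynomial (Module.Dual ℂ V) ℂ), f.IsHomogeneous d →
    (∀ q ∈ S, polyEval f q.rep = 0) → polyEval f p.rep = 0}

/-- The image in `ℙ(V)` of the nonzero vectors of a set. -/
def projectivize (S : Set V) : Set (ℙ ℂ V) :=
  {p | ∃ (v : V) (hv : v ≠ 0), v ∈ S ∧ p = Projectivization.mk ℂ v hv}

/-- The rank with respect to a set `S` of decomposable elements: the least length of an expression
as a sum of elements of `S`. -/
noncomputable def rankWrt (S : Set V) (v : V) : ℕ :=
  sInf {r | ∃ P : Fin r → V, (∀ i, P i ∈ S) ∧ v = ∑ i, P i}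

/-- The `r`-th secant variety: the Zariski closure of the set of points of rank at most `r`. -/
def secantVariety (r : ℕ) (S : Set V) : Set (ℙ ℂ V) :=
  zariskiClosure {p | rankWrt S p.rep ≤ r}

/-- The open join of `X` and `Y`: the points on the lines joining distinct points
`x ∈ X` and `y ∈ Y`. -/
def openJoin (X Y : Set (ℙ ℂ V)) : Set (ℙ ℂ V) :=
  {p | ∃ x ∈ X, ∃ y ∈ Y, x ≠ y ∧ p.submodule ≤ x.submodule ⊔ y.submodule}

end Projective

section Tensor

variable (A B C : Type*) [AddCommGroup A] [Module ℂ A] [AddCommGroup B] [Module ℂ B]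
  [AddCommGroup C] [Module ℂ C]

/-- The decomposable tensors `b ⊗ c`. They span the tensor product. -/
def simple₂ : Set (B ⊗[ℂ] C) := {M | ∃ (b : B) (c : C), M = b ⊗ₜ[ℂ] c}

/-- The decomposable tensors `a ⊗ b ⊗ c`. They span the tensor product. -/
def simple₃ : Set (A ⊗[ℂ] (B ⊗[ℂ] C)) :=
  {T | ∃ (a : A) (b : B) (c : C), T = a ⊗ₜ[ℂ] (b ⊗ₜ[ℂ] c)}

/-- The Segre variety of `ℙ(A) × ℙ(B) × ℙ(C)`. -/
def segreVariety : Set (ℙ ℂ (A ⊗[ℂ] (B ⊗[ℂ] C))) := projectivize (simple₃ A B C)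

/-- `ℙ(A) × Y`, for `Y ⊆ ℙ(B ⊗ C)`, in its Segre embedding: the points `[a ⊗ M]` with `[M] ∈ Y`. -/
def segreProduct {B C : Type*} [AddCommGroup B] [Module ℂ B] [AddCommGroup C] [Module ℂ C]
    (Y : Set (ℙ ℂ (B ⊗[ℂ] C))) : Set (ℙ ℂ (A ⊗[ℂ] (B ⊗[ℂ] C))) :=
  projectivize {T | ∃ (a : A) (M : B ⊗[ℂ] C) (hM : M ≠ 0),
    Projectivization.mk ℂ M hM ∈ Y ∧ T = a ⊗ₜ[ℂ] M}

/-- `Sub_{m₁ m₂ m₃}`: the tensors contained in some `A' ⊗ B' ⊗ C'`, with subspaces of dimensions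
`m₁`, `m₂`, `m₃`. -/
def subVariety (m₁ m₂ m₃ : ℕ) : Set (ℙ ℂ (A ⊗[ℂ] (B ⊗[ℂ] C))) :=
  projectivize {T | ∃ (A' : Submodule ℂ A) (B' : Submodule ℂ B) (C' : Submodule ℂ C),
    Module.finrank ℂ A' = m₁ ∧ Module.finrank ℂ B' = m₂ ∧ Module.finrank ℂ C' = m₃ ∧
    T ∈ LinearMap.range
      (TensorProduct.map A'.subtype (TensorProduct.map B'.subtype C'.subtype))}

variable {A B C}

/-- The tensor rank in `A ⊗ B ⊗ C`. -/
noncomputable def tensorRank (T : A ⊗[ℂ] (B ⊗[ℂ] C)) : ℕ := rankWrt (simple₃ A B C) T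

/-- The affine cone over the embedded tangent space of the Segre variety at `[a ⊗ b ⊗ c]`: all
tensors `x ⊗ b ⊗ c + a ⊗ y ⊗ c + a ⊗ b ⊗ z`, i.e. the image of the differential at `(a, b, c)` of
the parametrization `(a, b, c) ↦ a ⊗ b ⊗ c`. -/
def segreTangent (a : A) (b : B) (c : C) : Set (A ⊗[ℂ] (B ⊗[ℂ] C)) :=
  {ξ | ∃ (x : A) (y : B) (z : C),
    ξ = x ⊗ₜ[ℂ] (b ⊗ₜ[ℂ] c) + a ⊗ₜ[ℂ] (y ⊗ₜ[ℂ] c) + a ⊗ₜ[ℂ] (b ⊗ₜ[ℂ] z)}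

/-- The duality pairing between `A^∨ ⊗ B^∨ ⊗ C^∨` and `A ⊗ B ⊗ C`. -/
noncomputable def pairing
    (ξ : Module.Dual ℂ A ⊗[ℂ] (Module.Dual ℂ B ⊗[ℂ] Module.Dual ℂ C))
    (T : A ⊗[ℂ] (B ⊗[ℂ] C)) : ℂ :=
  TensorProduct.dualDistrib ℂ A (B ⊗[ℂ] C)
    (TensorProduct.map LinearMap.id (TensorProduct.dualDistrib ℂ B C) ξ) T

variable (A B C) in
/-- The dual variety, in `ℙ(A ⊗ B ⊗ C)`, of the Segre variety of `ℙ(A^∨) × ℙ(B^∨) × ℙ(C^∨)`: the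
Zariski closure of the set of the `[T]` whose hyperplane `{ξ | ⟨ξ, T⟩ = 0}` contains the embedded
tangent space of that Segre variety (which is smooth) at some point. -/
def segreDualVariety : Set (ℙ ℂ (A ⊗[ℂ] (B ⊗[ℂ] C))) :=
  zariskiClosure {p | ∃ (α : Module.Dual ℂ A) (β : Module.Dual ℂ B) (γ : Module.Dual ℂ C),
    α ≠ 0 ∧ β ≠ 0 ∧ γ ≠ 0 ∧ ∀ ξ ∈ segreTangent α β γ, pairing ξ p.rep = 0}

/-- The orbit of a tensor under `GL(A) × GL(B) × GL(C)`. -/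
def orbit (T : A ⊗[ℂ] (B ⊗[ℂ] C)) : Set (A ⊗[ℂ] (B ⊗[ℂ] C)) :=
  {S | ∃ (g₁ : A ≃ₗ[ℂ] A) (g₂ : B ≃ₗ[ℂ] B) (g₃ : C ≃ₗ[ℂ] C),
    S = TensorProduct.congr g₁ (TensorProduct.congr g₂ g₃) T}

/-- The decomposition locus: the triples `(a, b, c)` such that the rank of `T - t a ⊗ b ⊗ c` is
`rk(T) - 1` for some scalar `t`. -/
def decompositionLocus (T : A ⊗[ℂ] (B ⊗[ℂ] C)) : Set (A × B × C) :=
  {p | ∃ t : ℂ, tensorRank (T - t • (p.1 ⊗ₜ[ℂ] (p.2.1 ⊗ₜ[ℂ] p.2.2))) + 1 = tensorRank T}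

/-- The forbidden locus: the complement of the decomposition locus. -/
def forbiddenLocus (T : A ⊗[ℂ] (B ⊗[ℂ] C)) : Set (A × B × C) := (decompositionLocus T)ᶜ

end Tensor

/-- The space `ℂ² ⊗ ℂ³ ⊗ ℂ³`. -/
abbrev T233 : Type := (Fin 2 → ℂ) ⊗[ℂ] ((Fin 3 → ℂ) ⊗[ℂ] (Fin 3 → ℂ))

/-- The standard basis vectors of `ℂⁿ`, indexed from `0`. -/
def e {n : ℕ} (i : Fin n) : Fin n → ℂ := Pi.single i 1

/-- The tensor in `ℂ² ⊗ ℂ³ ⊗ ℂ³` of the pencil `uM + vN` of `3 × 3` matrices, i.e.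
`e₁ ⊗ M + e₂ ⊗ N`. -/
noncomputable def pencil (M N : (Fin 3 → ℂ) ⊗[ℂ] (Fin 3 → ℂ)) : T233 :=
  (e 0 : Fin 2 → ℂ) ⊗ₜ[ℂ] M + (e 1 : Fin 2 → ℂ) ⊗ₜ[ℂ] N

/-- The pencil with rows `(u, v, 0)`, `(0, 0, u)`, `(0, 0, v)`. -/
noncomputable def T₁₃ : T233 :=
  pencil (e 0 ⊗ₜ[ℂ] e 0 + e 1 ⊗ₜ[ℂ] e 2) (e 0 ⊗ₜ[ℂ] e 1 + e 2 ⊗ₜ[ℂ] e 2)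

/-- The pencil with rows `(u, 0, 0)`, `(0, u, 0)`, `(0, 0, v)`. -/
noncomputable def T₁₄ : T233 :=
  pencil (e 0 ⊗ₜ[ℂ] e 0 + e 1 ⊗ₜ[ℂ] e 1) (e 2 ⊗ₜ[ℂ] e 2)

/-- The pencil with rows `(u, v, 0)`, `(0, u, 0)`, `(0, 0, u)`. -/
noncomputable def T₁₅ : T233 :=
  pencil (e 0 ⊗ₜ[ℂ] e 0 + e 1 ⊗ₜ[ℂ] e 1 + e 2 ⊗ₜ[ℂ] e 2) (e 0 ⊗ₜ[ℂ] e 1)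

/-- The pencil with rows `(u, v, 0)`, `(0, u, v)`, `(0, 0, u)`. -/
noncomputable def T₁₆ : T233 :=
  pencil (e 0 ⊗ₜ[ℂ] e 0 + e 1 ⊗ₜ[ℂ] e 1 + e 2 ⊗ₜ[ℂ] e 2) (e 0 ⊗ₜ[ℂ] e 1 + e 1 ⊗ₜ[ℂ] e 2)

/-- The pencil with rows `(u, v, 0)`, `(0, u, 0)`, `(0, 0, v)`. -/
noncomputable def T₁₇ : T233 :=
  pencil (e 0 ⊗ₜ[ℂ] e 0 + e 1 ⊗ₜ[ℂ] e 1) (e 0 ⊗ₜ[ℂ] e 1 + e 2 ⊗ₜ[ℂ] e 2)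

/-- The Segre variety `X₂₃₃`. -/
def X₂₃₃ : Set (ℙ ℂ T233) := segreVariety (Fin 2 → ℂ) (Fin 3 → ℂ) (Fin 3 → ℂ)

/-- The dual variety `X₂₃₃^∨`. -/
def X₂₃₃Dual : Set (ℙ ℂ T233) := segreDualVariety (Fin 2 → ℂ) (Fin 3 → ℂ) (Fin 3 → ℂ)

/-- The secant variety `σ₂(X₂₃₃)`. -/
def σ₂X₂₃₃ : Set (ℙ ℂ T233) :=
  secantVariety 2 (simple₃ (Fin 2 → ℂ) (Fin 3 → ℂ) (Fin 3 → ℂ))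

/-- The secant variety `σ₂(X₃₃)`. -/
def σ₂X₃₃ : Set (ℙ ℂ ((Fin 3 → ℂ) ⊗[ℂ] (Fin 3 → ℂ))) :=
  secantVariety 2 (simple₂ (Fin 3 → ℂ) (Fin 3 → ℂ))

/-- `Sub_{m₁ m₂ m₃}` in `ℙ(ℂ² ⊗ ℂ³ ⊗ ℂ³)`. -/
def Sub₂₃₃ (m₁ m₂ m₃ : ℕ) : Set (ℙ ℂ T233) :=
  subVariety (Fin 2 → ℂ) (Fin 3 → ℂ) (Fin 3 → ℂ) m₁ m₂ m₃

/-- The open join `J°(X₂₃₃, ℙ¹ × σ₂(X₃₃))`. -/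
def J₀ : Set (ℙ ℂ T233) := openJoin X₂₃₃ (segreProduct (Fin 2 → ℂ) σ₂X₃₃)

end TensorLoci

open TensorLoci

/-! The tensors in the four orbits have rank 4, and subtracting a multiple of a decomposable tensor
lowers the rank by at most one. So `p` is forbidden exactly when every `T - t • P` has rank at least
4 (`mem_forbiddenLocus_iff`), and the first claim reduces to a description of all tensors of rank at
least 4 (`four_le_tensorRank_iff`).

View a tensor as a pencil `u S₀ + v S₁`, with binary cubic `det (u S₀ + v S₁)`. Tangency to the
Segre variety amounts to a double root of this cubic (`TangentAt.doubleRootAt`,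
`DoubleRootAt.exists_tangentAt`), so its discriminant vanishes on the dual variety. A pencil outside
the dual variety has three distinct roots, is simultaneously diagonalizable, and has rank at most 3
(`arrayRankLE_of_not_doubleRootAt`). The removed sets also have rank at most 3: the subspace
varieties because every `2 × 2 × 3` array does, the secant variety because it lies in `Sub₂₃₃ 2 2
3`, the join by its shape.

Conversely, let a nondegenerate tensor be `∑ a r ⊗ b r ⊗ c r` with three terms. Then the `b r` and
the `c r` are bases, and the cubic is a constant times the product of the linear forms given by the
`a r`. If its discriminant vanishes, two of the `a r` are parallel (`exists_parallel`); merging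
these two terms puts the tensor in `J₀`.

The lower bound 4 for the four normal forms comes from a Jordan chain, which a diagonal pencil
cannot have (`degenerateB_of_jordan`). For the closures, a point of `J₀` is `a ⊗ (b₀ ⊗ c₀ + b₁ ⊗ c₁)
+ a₁ ⊗ b₂ ⊗ c₂`, and it lies in the orbit of `T₁₄` as soon as the vectors in each factor form a
basis, which holds after a small perturbation. -/

namespace TensorLoci

open scoped Matrix

/-! ### Coordinates -/

/-- The coordinates of a tensor in `ℂ³ ⊗ ℂ³`. -/
noncomputable def coord₂ (j k : Fin 3) : (Fin 3 → ℂ) ⊗[ℂ] (Fin 3 → ℂ) →ₗ[ℂ] ℂ :=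
  LinearMap.mul' ℂ ℂ ∘ₗ TensorProduct.map (LinearMap.proj j) (LinearMap.proj k)

/-- The coordinates of a tensor in `ℂ² ⊗ ℂ³ ⊗ ℂ³`. -/
noncomputable def coord₃ (i : Fin 2) (j k : Fin 3) : T233 →ₗ[ℂ] ℂ :=
  LinearMap.mul' ℂ ℂ ∘ₗ TensorProduct.map (LinearMap.proj i) (coord₂ j k)

@[simp] theorem coord₂_tmul (j k : Fin 3) (b c : Fin 3 → ℂ) :
    coord₂ j k (b ⊗ₜ c) = b j * c k := by simp [coord₂]

@[simp] theorem coord₃_tmul (i : Fin 2) (j k : Fin 3) (a : Fin 2 → ℂ)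
    (M : (Fin 3 → ℂ) ⊗[ℂ] (Fin 3 → ℂ)) :
    coord₃ i j k (a ⊗ₜ M) = a i * coord₂ j k M := by simp [coord₃]

theorem sum_smul_e {n : ℕ} (a : Fin n → ℂ) : ∑ i, a i • (e i : Fin n → ℂ) = a := by
  ext j; simp [e, Pi.single_apply]

theorem eq_sum_coord₂ (M : (Fin 3 → ℂ) ⊗[ℂ] (Fin 3 → ℂ)) :
    M = ∑ j, ∑ k, coord₂ j k M • (e j ⊗ₜ[ℂ] e k) := by
  induction M with
  | zero => simp
  | add x y hx hy =>
    simp only [map_add, add_smul, Finset.sum_add_distrib]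
    rw [← hx, ← hy]
  | tmul b c =>
    conv_lhs => rw [← sum_smul_e b, ← sum_smul_e c]
    simp only [TensorProduct.sum_tmul, TensorProduct.tmul_sum, TensorProduct.smul_tmul_smul,
      coord₂_tmul]
    exact Finset.sum_comm

theorem eq_sum_coord₃ (T : T233) :
    T = ∑ i, ∑ j, ∑ k, coord₃ i j k T • (e i ⊗ₜ[ℂ] (e j ⊗ₜ[ℂ] e k)) := by
  induction T using TensorProduct.induction_on with
  | zero => simp
  | add x y hx hy =>
    simp only [map_add, add_smul, Finset.sum_add_distrib]
    rw [← hx, ← hy]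
  | tmul a M =>
    conv_lhs => rw [← sum_smul_e a, eq_sum_coord₂ M, TensorProduct.sum_tmul]
    simp only [TensorProduct.tmul_sum, TensorProduct.smul_tmul_smul, coord₃_tmul]

theorem ext_coord₂ {M N : (Fin 3 → ℂ) ⊗[ℂ] (Fin 3 → ℂ)}
    (h : ∀ j k, coord₂ j k M = coord₂ j k N) : M = N := by
  rw [eq_sum_coord₂ M, eq_sum_coord₂ N]; simp only [h]

theorem ext_coord₃ {S T : T233} (h : ∀ i j k, coord₃ i j k S = coord₃ i j k T) : S = T := by
  rw [eq_sum_coord₃ S, eq_sum_coord₃ T]; simp only [h]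

/-- The matrix of a tensor in `ℂ³ ⊗ ℂ³`. -/
noncomputable def toMat (M : (Fin 3 → ℂ) ⊗[ℂ] (Fin 3 → ℂ)) : Matrix (Fin 3) (Fin 3) ℂ :=
  Matrix.of fun j k => coord₂ j k M

/-- The two matrices of a pencil. -/
noncomputable def slice (T : T233) (i : Fin 2) : Matrix (Fin 3) (Fin 3) ℂ :=
  Matrix.of fun j k => coord₃ i j k T

/-! ### Rank -/

section Rank

variable {V : Type*} [AddCommGroup V] [Module ℂ V]

/-- Spanning and scaling make the set of lengths nonempty, so that its infimum is attained and is
not the default value 0; zero summands then pad an expression to length exactly `n`. -/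
theorem rankWrt_le_iff {S : Set V} (h0 : (0 : V) ∈ S) (hsmul : ∀ (c : ℂ), ∀ v ∈ S, c • v ∈ S)
    (hS : Submodule.span ℂ S = ⊤) (n : ℕ) (v : V) :
    rankWrt S v ≤ n ↔ ∃ P : Fin n → V, (∀ i, P i ∈ S) ∧ v = ∑ i, P i := by
  constructor
  · intro h
    have hne : {r | ∃ P : Fin r → V, (∀ i, P i ∈ S) ∧ v = ∑ i, P i}.Nonempty := by
      have hv : v ∈ Submodule.span ℂ S := hS ▸ Submodule.mem_top
      obtain ⟨m, f, g, hfg⟩ := Submodule.mem_span_set'.1 hv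
      exact ⟨m, fun i => f i • (g i : V), fun i => hsmul _ _ (g i).2, hfg.symm⟩
    have hr : ∃ P : Fin (rankWrt S v) → V, (∀ i, P i ∈ S) ∧ v = ∑ i, P i := Nat.sInf_mem hne
    obtain ⟨k, rfl⟩ := Nat.exists_eq_add_of_le h
    generalize rankWrt S v = r at hr
    obtain ⟨P, hP, hv⟩ := hr
    refine ⟨Fin.append P (fun _ : Fin k => 0), fun i => ?_, ?_⟩
    · refine Fin.addCases (fun i => ?_) (fun i => ?_) i
      · simpa using hP i
      · simpa using h0
    · rw [Fin.sum_univ_add]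
      simpa using hv
  · exact fun h => Nat.sInf_le h

end Rank

theorem simple₂_rankWrt_le_iff (n : ℕ) (M : (Fin 3 → ℂ) ⊗[ℂ] (Fin 3 → ℂ)) :
    rankWrt (simple₂ (Fin 3 → ℂ) (Fin 3 → ℂ)) M ≤ n ↔
      ∃ b c : Fin n → Fin 3 → ℂ, M = ∑ r, b r ⊗ₜ[ℂ] c r := by
  rw [rankWrt_le_iff]
  · constructor
    · rintro ⟨P, hP, rfl⟩
      choose b c h using hP
      exact ⟨b, c, by simp only [h]⟩
    · rintro ⟨b, c, rfl⟩
      exact ⟨fun r => b r ⊗ₜ c r, fun i => ⟨_, _, rfl⟩, rfl⟩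
  · exact ⟨0, 0, by simp⟩
  · rintro c _ ⟨x, y, rfl⟩
    exact ⟨c • x, y, by rw [TensorProduct.smul_tmul']⟩
  · rw [eq_top_iff]
    intro M _
    rw [eq_sum_coord₂ M]
    exact Submodule.sum_mem _ fun j _ => Submodule.sum_mem _ fun k _ =>
      Submodule.smul_mem _ _ (Submodule.subset_span ⟨_, _, rfl⟩)

theorem tensorRank_le_iff_simple (n : ℕ) (T : T233) :
    tensorRank T ≤ n ↔ ∃ P : Fin n → T233,
      (∀ i, P i ∈ simple₃ (Fin 2 → ℂ) (Fin 3 → ℂ) (Fin 3 → ℂ)) ∧ T = ∑ i, P i := by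
  rw [tensorRank, rankWrt_le_iff]
  · exact ⟨0, 0, 0, by simp⟩
  · rintro c _ ⟨x, y, z, rfl⟩
    exact ⟨c • x, y, z, by rw [TensorProduct.smul_tmul']⟩
  · rw [eq_top_iff]
    intro M _
    rw [eq_sum_coord₃ M]
    exact Submodule.sum_mem _ fun i _ => Submodule.sum_mem _ fun j _ => Submodule.sum_mem _
      fun k _ => Submodule.smul_mem _ _ (Submodule.subset_span ⟨_, _, _, rfl⟩)

theorem tensorRank_le_iff (n : ℕ) (T : T233) :
    tensorRank T ≤ n ↔ ∃ (a : Fin n → Fin 2 → ℂ) (b c : Fin n → Fin 3 → ℂ),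
      T = ∑ r, a r ⊗ₜ[ℂ] (b r ⊗ₜ[ℂ] c r) := by
  rw [tensorRank_le_iff_simple]
  constructor
  · rintro ⟨P, hP, rfl⟩
    choose a b c h using hP
    exact ⟨a, b, c, by simp only [h]⟩
  · rintro ⟨a, b, c, rfl⟩
    exact ⟨fun r => a r ⊗ₜ (b r ⊗ₜ c r), fun i => ⟨_, _, _, rfl⟩, rfl⟩

/-- The array `S` is a sum of `n` products. -/
def ArrayRankLE (n : ℕ) (S : Fin 2 → Matrix (Fin 3) (Fin 3) ℂ) : Prop :=
  ∃ (a : Fin n → Fin 2 → ℂ) (b c : Fin n → Fin 3 → ℂ),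
    ∀ i j k, S i j k = ∑ r, a r i * (b r j * c r k)

theorem tensorRank_le_iff_slice (n : ℕ) (T : T233) :
    tensorRank T ≤ n ↔ ArrayRankLE n (slice T) := by
  rw [tensorRank_le_iff]
  constructor
  · rintro ⟨a, b, c, rfl⟩
    exact ⟨a, b, c, fun i j k => by simp [slice]⟩
  · rintro ⟨a, b, c, h⟩
    refine ⟨a, b, c, ext_coord₃ fun i j k => ?_⟩
    have := h i j k
    simp only [slice, Matrix.of_apply] at this
    rw [this]; simp

theorem tensorRank_add_simple_le {n : ℕ} {T : T233} (h : tensorRank T ≤ n) (a : Fin 2 → ℂ)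
    (b c : Fin 3 → ℂ) : tensorRank (T + a ⊗ₜ[ℂ] (b ⊗ₜ[ℂ] c)) ≤ n + 1 := by
  rw [tensorRank_le_iff] at h ⊢
  obtain ⟨a', b', c', rfl⟩ := h
  exact ⟨Fin.snoc a' a, Fin.snoc b' b, Fin.snoc c' c, by simp [Fin.sum_univ_castSucc]⟩

theorem tensorRank_congr_le (g₁ : (Fin 2 → ℂ) ≃ₗ[ℂ] (Fin 2 → ℂ))
    (g₂ g₃ : (Fin 3 → ℂ) ≃ₗ[ℂ] (Fin 3 → ℂ)) {n : ℕ} {T : T233} (h : tensorRank T ≤ n) :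
    tensorRank (TensorProduct.congr g₁ (TensorProduct.congr g₂ g₃) T) ≤ n := by
  rw [tensorRank_le_iff] at h ⊢
  obtain ⟨a, b, c, rfl⟩ := h
  exact ⟨fun r => g₁ (a r), fun r => g₂ (b r), fun r => g₃ (c r), by simp⟩

theorem tensorRank_eq_of_mem_orbit {S T : T233} (h : S ∈ orbit T) :
    tensorRank S = tensorRank T := by
  obtain ⟨g₁, g₂, g₃, rfl⟩ := h
  refine le_antisymm (tensorRank_congr_le _ _ _ le_rfl) ?_
  have := tensorRank_congr_le g₁.symm g₂.symm g₃.symm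
    (le_refl (tensorRank (TensorProduct.congr g₁ (TensorProduct.congr g₂ g₃) T)))
  rwa [← TensorProduct.congr_symm, ← TensorProduct.congr_symm, LinearEquiv.symm_apply_apply] at this

/-! ### Polynomial functions -/

section Poly

variable {V : Type*} [AddCommGroup V] [Module ℂ V]

/-- Homogeneous polynomial functions of degree `d`. -/
def IsHomPoly (d : ℕ) (F : V → ℂ) : Prop :=
  ∃ f : MvPolynomial (Module.Dual ℂ V) ℂ, f.IsHomogeneous d ∧ ∀ v, polyEval f v = F v

theorem IsHomPoly.linear (φ : Module.Dual ℂ V) : IsHomPoly 1 (fun v => φ v) :=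
  ⟨MvPolynomial.X φ, MvPolynomial.isHomogeneous_X _ _, fun v => by simp [polyEval]⟩

theorem IsHomPoly.add {d : ℕ} {F G : V → ℂ} (hF : IsHomPoly d F) (hG : IsHomPoly d G) :
    IsHomPoly d (fun v => F v + G v) := by
  obtain ⟨f, hf, hF⟩ := hF
  obtain ⟨g, hg, hG⟩ := hG
  exact ⟨f + g, hf.add hg, fun v => by simp only [← hF, ← hG]; simp [polyEval]⟩

theorem IsHomPoly.mul {d d' : ℕ} {F G : V → ℂ} (hF : IsHomPoly d F) (hG : IsHomPoly d' G) :
    IsHomPoly (d + d') (fun v => F v * G v) := by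
  obtain ⟨f, hf, hF⟩ := hF
  obtain ⟨g, hg, hG⟩ := hG
  exact ⟨f * g, hf.mul hg, fun v => by simp only [← hF, ← hG]; simp [polyEval]⟩

theorem IsHomPoly.const_mul {d : ℕ} {F : V → ℂ} (c : ℂ) (hF : IsHomPoly d F) :
    IsHomPoly d (fun v => c * F v) := by
  obtain ⟨f, hf, hF⟩ := hF
  refine ⟨MvPolynomial.C c * f, ?_, fun v => by simp only [← hF]; simp [polyEval]⟩
  simpa using (MvPolynomial.isHomogeneous_C _ c).mul hf

theorem IsHomPoly.sub {d : ℕ} {F G : V → ℂ} (hF : IsHomPoly d F) (hG : IsHomPoly d G) :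
    IsHomPoly d (fun v => F v - G v) := by
  simpa [sub_eq_add_neg] using hF.add (hG.const_mul (-1))

theorem IsHomPoly.pow {d : ℕ} {F : V → ℂ} (hF : IsHomPoly d F) (n : ℕ) :
    IsHomPoly (d * n) (fun v => F v ^ n) := by
  obtain ⟨f, hf, hF⟩ := hF
  exact ⟨f ^ n, hf.pow n, fun v => by simp only [← hF]; simp [polyEval]⟩

theorem IsHomPoly.det {F : Fin 3 → Fin 3 → V → ℂ} (hF : ∀ i j, IsHomPoly 1 (F i j)) :
    IsHomPoly 3 (fun v => (Matrix.of fun i j => F i j v).det) := by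
  simp only [Matrix.det_fin_three, Matrix.of_apply]
  have h := fun i j k l m n => ((hF i j).mul (hF k l)).mul (hF m n)
  exact (((((h _ _ _ _ _ _).sub (h _ _ _ _ _ _)).sub (h _ _ _ _ _ _)).add
    (h _ _ _ _ _ _)).add (h _ _ _ _ _ _)).sub (h _ _ _ _ _ _)

theorem polyEval_smul {d : ℕ} {f : MvPolynomial (Module.Dual ℂ V) ℂ} (hf : f.IsHomogeneous d)
    (c : ℂ) (v : V) : polyEval f (c • v) = c ^ d * polyEval f v := by
  simp only [polyEval, MvPolynomial.eval_eq, map_smul, smul_eq_mul, mul_pow,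
    Finset.prod_mul_distrib, Finset.prod_pow_eq_pow_sum, Finset.mul_sum]
  refine Finset.sum_congr rfl fun m hm => ?_
  have : ∑ i ∈ m.support, m i = d := by
    rw [← hf (MvPolynomial.mem_support_iff.1 hm), Finsupp.weight_apply]
    simp [Finsupp.sum]
  rw [this]; ring

theorem exists_rep_eq_smul {v : V} (hv : v ≠ 0) :
    ∃ c : ℂ, c ≠ 0 ∧ (Projectivization.mk ℂ v hv).rep = c • v := by
  obtain ⟨u, hu⟩ := Projectivization.exists_smul_eq_mk_rep ℂ v hv
  exact ⟨u, u.ne_zero, hu.symm⟩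

/-- `zariskiClosure` evaluates at a chosen representative; by homogeneity the choice does not affect
vanishing. -/
theorem polyEval_mk_rep_eq_zero_iff {d : ℕ} {f : MvPolynomial (Module.Dual ℂ V) ℂ}
    (hf : f.IsHomogeneous d) {v : V} (hv : v ≠ 0) :
    polyEval f (Projectivization.mk ℂ v hv).rep = 0 ↔ polyEval f v = 0 := by
  obtain ⟨c, hc, h⟩ := exists_rep_eq_smul hv
  rw [h, polyEval_smul hf]
  simp [hc]

theorem subset_zariskiClosure (S : Set (ℙ ℂ V)) : S ⊆ zariskiClosure S :=
  fun _ hp _ _ _ h => h _ hp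

theorem zariskiClosure_subset {S T : Set (ℙ ℂ V)} (h : S ⊆ zariskiClosure T) :
    zariskiClosure S ⊆ zariskiClosure T :=
  fun _ hp d f hf hT => hp d f hf fun _ hq => h hq d f hf hT

theorem IsHomPoly.eq_zero_of_mem_zariskiClosure {d : ℕ} {F : V → ℂ} (hF : IsHomPoly d F)
    {S : Set (ℙ ℂ V)} (hS : ∀ q ∈ S, F q.rep = 0) {v : V} (hv : v ≠ 0)
    (h : Projectivization.mk ℂ v hv ∈ zariskiClosure S) : F v = 0 := by
  obtain ⟨f, hf, hF⟩ := hF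
  rw [← hF, ← polyEval_mk_rep_eq_zero_iff hf hv]
  exact h d f hf fun q hq => by rw [hF]; exact hS q hq

end Poly

/-! ### The polar form of the determinant -/

/-- The derivative of the determinant at `K` in the direction `L`. -/
noncomputable def detPolar (K L : Matrix (Fin 3) (Fin 3) ℂ) : ℂ := (K.adjugate * L).trace

theorem detPolar_eq (K L : Matrix (Fin 3) (Fin 3) ℂ) : detPolar K L =
    L 0 0 * (K 1 1 * K 2 2 - K 1 2 * K 2 1) + L 1 0 * (K 0 2 * K 2 1 - K 0 1 * K 2 2)
    + L 2 0 * (K 0 1 * K 1 2 - K 0 2 * K 1 1) + L 0 1 * (K 1 2 * K 2 0 - K 1 0 * K 2 2)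
    + L 1 1 * (K 0 0 * K 2 2 - K 0 2 * K 2 0) + L 2 1 * (K 0 2 * K 1 0 - K 0 0 * K 1 2)
    + L 0 2 * (K 1 0 * K 2 1 - K 1 1 * K 2 0) + L 1 2 * (K 0 1 * K 2 0 - K 0 0 * K 2 1)
    + L 2 2 * (K 0 0 * K 1 1 - K 0 1 * K 1 0) := by
  simp [detPolar, Matrix.adjugate_fin_three, Matrix.trace_fin_three, Matrix.vecMul, dotProduct,
    Fin.sum_univ_three]
  ring

/-- Replacing column `j` of `K + εL` by `(K + εL) γ` multiplies the determinant by `γ j`. As `K γ =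
0`, the new column is `ε L γ`, and the coefficients of `ε` give the identity. -/
theorem det_updateCol_mulVec (K L : Matrix (Fin 3) (Fin 3) ℂ) (γ : Fin 3 → ℂ)
    (hγ : K *ᵥ γ = 0) (j : Fin 3) :
    (K.updateCol j (L *ᵥ γ)).det = γ j * detPolar K L := by
  have h : ∀ i, K i 0 * γ 0 + K i 1 * γ 1 + K i 2 * γ 2 = 0 := fun i => by
    have := congrFun hγ i
    simpa [Matrix.mulVec, dotProduct, Fin.sum_univ_three] using this
  have h0 := h 0
  have h1 := h 1
  have h2 := h 2
  -- The two sides differ by determinants having `K γ` as a column.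
  have key : ∀ x y : Fin 3 → ℂ, !![K 0 0 * γ 0 + K 0 1 * γ 1 + K 0 2 * γ 2, x 0, y 0;
      K 1 0 * γ 0 + K 1 1 * γ 1 + K 1 2 * γ 2, x 1, y 1;
      K 2 0 * γ 0 + K 2 1 * γ 1 + K 2 2 * γ 2, x 2, y 2].det = 0 := fun x y => by
    rw [h0, h1, h2]; simp [Matrix.det_fin_three]
  rw [detPolar_eq]
  fin_cases j
  · have e1 := key (fun i => L i 1) (fun i => K i 2)
    have e2 := key (fun i => K i 1) (fun i => L i 2)
    simp [Matrix.det_fin_three, Matrix.mulVec, dotProduct, Fin.sum_univ_three] at e1 e2 ⊢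
    linear_combination -e1 - e2
  · have e1 := key (fun i => L i 0) (fun i => K i 2)
    have e2 := key (fun i => K i 0) (fun i => L i 2)
    simp [Matrix.det_fin_three, Matrix.mulVec, dotProduct, Fin.sum_univ_three] at e1 e2 ⊢
    linear_combination e1 + e2
  · have e1 := key (fun i => L i 0) (fun i => K i 1)
    have e2 := key (fun i => K i 0) (fun i => L i 1)
    simp [Matrix.det_fin_three, Matrix.mulVec, dotProduct, Fin.sum_univ_three] at e1 e2 ⊢
    linear_combination -e1 - e2

theorem detPolar_self (K : Matrix (Fin 3) (Fin 3) ℂ) : detPolar K K = 3 * K.det := by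
  simp [detPolar, Matrix.adjugate_mul]; ring

theorem detPolar_add_smul (K L : Matrix (Fin 3) (Fin 3) ℂ) (a : ℂ)
    (P : Matrix (Fin 3) (Fin 3) ℂ) (b : ℂ) :
    detPolar K (a • L + b • P) = a * detPolar K L + b * detPolar K P := by
  simp [detPolar, Matrix.mul_add]

/-- This is the derivative of `det (X K Y) = det X det K det Y`. -/
theorem detPolar_mul_mul (X Y K L : Matrix (Fin 3) (Fin 3) ℂ) :
    detPolar (X * K * Y) (X * L * Y) = X.det * Y.det * detPolar K L := by
  have h1 : Y * Y.adjugate = Y.det • (1 : Matrix (Fin 3) (Fin 3) ℂ) := Matrix.mul_adjugate Y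
  have h2 : X.adjugate * X = X.det • (1 : Matrix (Fin 3) (Fin 3) ℂ) := Matrix.adjugate_mul X
  rw [detPolar, Matrix.adjugate_mul_distrib, Matrix.adjugate_mul_distrib]
  have : Y.adjugate * (K.adjugate * X.adjugate) * (X * L * Y) =
      Y.adjugate * (K.adjugate * ((X.adjugate * X) * (L * Y))) := by
    simp only [Matrix.mul_assoc]
  rw [this, h2, Matrix.trace_mul_comm]
  have : K.adjugate * (X.det • (1 : Matrix (Fin 3) (Fin 3) ℂ) * (L * Y)) * Y.adjugate =
      X.det • (K.adjugate * L * (Y * Y.adjugate)) := by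
    simp [Matrix.mul_assoc]
  rw [this, h1, detPolar]
  simp; ring

/-! ### Degenerate pencils -/

/-- The hyperplane of `S` is tangent to the Segre variety at `[α ⊗ β ⊗ γ]`. -/
def TangentAt (S : Fin 2 → Matrix (Fin 3) (Fin 3) ℂ) (α : Fin 2 → ℂ) (β γ : Fin 3 → ℂ) : Prop :=
  (∀ i, β ⬝ᵥ S i *ᵥ γ = 0) ∧ β ᵥ* (α 0 • S 0 + α 1 • S 1) = 0 ∧
    (α 0 • S 0 + α 1 • S 1) *ᵥ γ = 0

/-- `det (u S₀ + v S₁)` vanishes to second order at `α`. -/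
def DoubleRootAt (S : Fin 2 → Matrix (Fin 3) (Fin 3) ℂ) (α : Fin 2 → ℂ) : Prop :=
  (α 0 • S 0 + α 1 • S 1).det = 0 ∧ ∀ i, detPolar (α 0 • S 0 + α 1 • S 1) (S i) = 0

theorem exists_apply_ne_zero {n : ℕ} {γ : Fin n → ℂ} (h : γ ≠ 0) : ∃ j, γ j ≠ 0 :=
  Function.ne_iff.1 h

theorem vecMul_updateCol_eq_zero_iff (K : Matrix (Fin 3) (Fin 3) ℂ) (β w : Fin 3 → ℂ)
    (j : Fin 3) : β ᵥ* (K.updateCol j w) = 0 ↔ β ⬝ᵥ w = 0 ∧ ∀ l, l ≠ j → (β ᵥ* K) l = 0 := by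
  have key : ∀ l, (β ᵥ* (K.updateCol j w)) l = if l = j then β ⬝ᵥ w else (β ᵥ* K) l := by
    intro l
    split_ifs with h
    · subst h; simp [Matrix.vecMul, dotProduct]
    · simp [Matrix.vecMul, dotProduct, h]
  constructor
  · intro h
    refine ⟨?_, fun l hl => ?_⟩
    · have := congrFun h j
      rw [key] at this; simpa using this
    · have := congrFun h l
      rw [key] at this; simpa [hl] using this
  · rintro ⟨h1, h2⟩
    ext l
    rw [key]
    split_ifs with h
    · exact h1
    · exact h2 l h

/-- With `K` the member of the pencil at `α`, the form `β` kills the columns of `K` and also `S i *ᵥ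
γ`. So `K` with a column replaced by `S i *ᵥ γ` is singular, and `det_updateCol_mulVec` applies. -/
theorem TangentAt.doubleRootAt {S : Fin 2 → Matrix (Fin 3) (Fin 3) ℂ} {α : Fin 2 → ℂ}
    {β γ : Fin 3 → ℂ} (hβ : β ≠ 0) (hγ : γ ≠ 0) (h : TangentAt S α β γ) : DoubleRootAt S α := by
  obtain ⟨h1, h2, h3⟩ := h
  refine ⟨Matrix.exists_mulVec_eq_zero_iff.1 ⟨γ, hγ, h3⟩, fun i => ?_⟩
  obtain ⟨j, hj⟩ := exists_apply_ne_zero hγ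
  have h4 := det_updateCol_mulVec _ (S i) γ h3 j
  rw [Matrix.exists_vecMul_eq_zero_iff.1 ⟨β, hβ,
    (vecMul_updateCol_eq_zero_iff _ _ _ _).2 ⟨h1 i, fun l _ => congrFun h2 l⟩⟩] at h4
  simpa [hj] using h4.symm

theorem DoubleRootAt.exists_tangentAt {S : Fin 2 → Matrix (Fin 3) (Fin 3) ℂ} {α : Fin 2 → ℂ}
    (hα : α ≠ 0) (h : DoubleRootAt S α) : ∃ β γ, β ≠ 0 ∧ γ ≠ 0 ∧ TangentAt S α β γ := by
  obtain ⟨h1, h2⟩ := h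
  obtain ⟨γ, hγ, h3⟩ := Matrix.exists_mulVec_eq_zero_iff.2 h1
  obtain ⟨j, hj⟩ := exists_apply_ne_zero hγ
  obtain ⟨i₀, hi₀⟩ := exists_apply_ne_zero hα
  -- The other index. Here `β` is built for the slice `i₁`; slice `i₀` follows from `h8`, because `α
  -- i₀ ≠ 0`.
  set i₁ : Fin 2 := 1 - i₀ with hi₁
  have h4 := det_updateCol_mulVec _ (S i₁) γ h3 j
  rw [h2, mul_zero] at h4
  obtain ⟨β, hβ, h5⟩ := Matrix.exists_vecMul_eq_zero_iff.2 h4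
  rw [vecMul_updateCol_eq_zero_iff] at h5
  have h6 : β ᵥ* (α 0 • S 0 + α 1 • S 1) = 0 := by
    -- Only column `j` remains to be killed by `β`, and `γ j ≠ 0` recovers it from the relation `K γ
    -- = 0`.
    have h7 : (β ᵥ* (α 0 • S 0 + α 1 • S 1)) ⬝ᵥ γ = 0 := by
      rw [← Matrix.dotProduct_mulVec, h3, dotProduct_zero]
    rw [dotProduct, Finset.sum_eq_single j (fun l _ hl => by rw [h5.2 l hl, zero_mul])
      (by simp)] at h7
    ext l
    by_cases hl : l = j
    · subst hl; simpa [hj] using h7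
    · exact h5.2 l hl
  have h8 : α 0 * (β ⬝ᵥ S 0 *ᵥ γ) + α 1 * (β ⬝ᵥ S 1 *ᵥ γ) = 0 := by
    have := congrArg (β ⬝ᵥ ·) h3
    simpa [Matrix.add_mulVec, Matrix.smul_mulVec, dotProduct_add, dotProduct_smul] using this
  refine ⟨β, γ, hβ, hγ, ?_, h6, h3⟩
  have h9 := h5.1
  fin_cases i₀
  · have : i₁ = 1 := rfl
    rw [this] at h9
    have h10 : β ⬝ᵥ S 0 *ᵥ γ = 0 := by
      have : α 0 ≠ 0 := hi₀
      simpa [h9, this] using h8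
    exact Fin.forall_fin_two.2 ⟨h10, h9⟩
  · have : i₁ = 0 := rfl
    rw [this] at h9
    have h10 : β ⬝ᵥ S 1 *ᵥ γ = 0 := by
      have : α 1 ≠ 0 := hi₀
      simpa [h9, this] using h8
    exact Fin.forall_fin_two.2 ⟨h9, h10⟩

/-- The discriminant of the binary cubic form `A u³ + B u² v + C u v² + D v³`. -/
def cubicDisc (A B C D : ℂ) : ℂ :=
  B ^ 2 * C ^ 2 - 4 * (A * C ^ 3) - 4 * (B ^ 3 * D) - 27 * (A ^ 2 * D ^ 2) + 18 * (A * B * (C * D))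

/-- The discriminant of the binary cubic form `det (u S₀ + v S₁)`. -/
noncomputable def pencilDisc (S : Fin 2 → Matrix (Fin 3) (Fin 3) ℂ) : ℂ :=
  cubicDisc (S 0).det (detPolar (S 0) (S 1)) (detPolar (S 1) (S 0)) (S 1).det

theorem det_pencil (M N : Matrix (Fin 3) (Fin 3) ℂ) (u v : ℂ) : (u • M + v • N).det =
    M.det * u ^ 3 + detPolar M N * u ^ 2 * v + detPolar N M * u * v ^ 2 + N.det * v ^ 3 := by
  simp only [detPolar_eq, Matrix.det_fin_three, Matrix.add_apply, Matrix.smul_apply, smul_eq_mul]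
  ring

theorem detPolar_pencil_left (M N : Matrix (Fin 3) (Fin 3) ℂ) (u v : ℂ) :
    detPolar (u • M + v • N) M =
      3 * M.det * u ^ 2 + 2 * detPolar M N * u * v + detPolar N M * v ^ 2 := by
  simp only [detPolar_eq, Matrix.det_fin_three, Matrix.add_apply, Matrix.smul_apply, smul_eq_mul]
  ring

theorem detPolar_pencil_right (M N : Matrix (Fin 3) (Fin 3) ℂ) (u v : ℂ) :
    detPolar (u • M + v • N) N =
      detPolar M N * u ^ 2 + 2 * detPolar N M * u * v + 3 * N.det * v ^ 2 := by
  simp only [detPolar_eq, Matrix.det_fin_three, Matrix.add_apply, Matrix.smul_apply, smul_eq_mul]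
  ring

/-- The hypotheses are the vanishing of both partial derivatives at `(u, v)`. In an affine chart
they can be solved for two of the coefficients, and the discriminant then vanishes identically. -/
theorem cubicDisc_eq_zero {A B C D u v : ℂ} (huv : u ≠ 0 ∨ v ≠ 0)
    (h1 : 3 * A * u ^ 2 + 2 * B * u * v + C * v ^ 2 = 0)
    (h2 : B * u ^ 2 + 2 * C * u * v + 3 * D * v ^ 2 = 0) : cubicDisc A B C D = 0 := by
  rw [cubicDisc]
  rcases huv with hu | hv
  · obtain ⟨x, rfl⟩ : ∃ x, v = u * x := ⟨v / u, by field_simp⟩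
    have hB : B = -(2 * C * x + 3 * D * x ^ 2) := by
      have : u ^ 2 * (B + (2 * C * x + 3 * D * x ^ 2)) = 0 := by linear_combination h2
      rcases mul_eq_zero.1 this with h | h
      · simp [hu] at h
      · linear_combination h
    have hA : A = -(2 * B * x + C * x ^ 2) / 3 := by
      have : u ^ 2 * (3 * A + (2 * B * x + C * x ^ 2)) = 0 := by linear_combination h1
      rcases mul_eq_zero.1 this with h | h
      · simp [hu] at h
      · linear_combination h / 3
    subst hA; subst hB; ring
  · obtain ⟨x, rfl⟩ : ∃ x, u = v * x := ⟨u / v, by field_simp⟩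
    have hC : C = -(2 * B * x + 3 * A * x ^ 2) := by
      have : v ^ 2 * (C + (2 * B * x + 3 * A * x ^ 2)) = 0 := by linear_combination h1
      rcases mul_eq_zero.1 this with h | h
      · simp [hv] at h
      · linear_combination h
    have hD : D = -(2 * C * x + B * x ^ 2) / 3 := by
      have : v ^ 2 * (3 * D + (2 * C * x + B * x ^ 2)) = 0 := by linear_combination h2
      rcases mul_eq_zero.1 this with h | h
      · simp [hv] at h
      · linear_combination h / 3
    subst hD; subst hC; ring

theorem DoubleRootAt.pencilDisc_eq_zero {S : Fin 2 → Matrix (Fin 3) (Fin 3) ℂ} {α : Fin 2 → ℂ}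
    (hα : α ≠ 0) (h : DoubleRootAt S α) : pencilDisc S = 0 := by
  have h0 := h.2 0
  have h1 := h.2 1
  rw [detPolar_pencil_left] at h0
  rw [detPolar_pencil_right] at h1
  refine cubicDisc_eq_zero (u := α 0) (v := α 1) ?_ h0 h1
  by_contra! hc
  exact hα (funext (Fin.forall_fin_two.2 hc))

/-! ### Pencils of rank at most three -/

/-- The matrices of a sum of three decomposable tensors. -/
theorem slice_eq_of_sum_three {S : Fin 2 → Matrix (Fin 3) (Fin 3) ℂ} {a : Fin 3 → Fin 2 → ℂ}
    {b c : Fin 3 → Fin 3 → ℂ} (h : ∀ i j k, S i j k = ∑ r, a r i * (b r j * c r k)) (i : Fin 2) :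
    S i = (Matrix.of b)ᵀ * Matrix.diagonal (fun r => a r i) * Matrix.of c := by
  ext j k
  rw [h, Matrix.mul_apply]
  exact Finset.sum_congr rfl fun r _ => by simp [Matrix.mul_diagonal]; ring

/-- The cubic is `det b * det c` times the product of the forms `a r 0 * u + a r 1 * v`, so its
discriminant is a nonzero constant times the squared product of the pairwise minors of the `a r`. -/
theorem exists_parallel {S : Fin 2 → Matrix (Fin 3) (Fin 3) ℂ} {a : Fin 3 → Fin 2 → ℂ}
    {b c : Fin 3 → Fin 3 → ℂ} (h : ∀ i j k, S i j k = ∑ r, a r i * (b r j * c r k))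
    (hb : (Matrix.of b).det ≠ 0) (hc : (Matrix.of c).det ≠ 0) (hS : pencilDisc S = 0) :
    a 0 0 * a 1 1 = a 0 1 * a 1 0 ∨ a 0 0 * a 2 1 = a 0 1 * a 2 0 ∨
      a 1 0 * a 2 1 = a 1 1 * a 2 0 := by
  have h1 : pencilDisc S = ((Matrix.of b).det * (Matrix.of c).det) ^ 4 *
      ((a 0 0 * a 1 1 - a 0 1 * a 1 0) * (a 0 0 * a 2 1 - a 0 1 * a 2 0) *
      (a 1 0 * a 2 1 - a 1 1 * a 2 0)) ^ 2 := by
    rw [pencilDisc, slice_eq_of_sum_three h 0, slice_eq_of_sum_three h 1, detPolar_mul_mul,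
      detPolar_mul_mul]
    simp only [Matrix.det_mul, Matrix.det_transpose, Matrix.det_diagonal, Fin.prod_univ_three,
      detPolar_eq, cubicDisc, Matrix.diagonal_apply]
    simp
    ring
  rw [h1] at hS
  simpa [hb, hc, sub_eq_zero, or_assoc] using hS

/-- Some linear form on `B` annihilates the pencil. -/
def DegenerateB (S : Fin 2 → Matrix (Fin 3) (Fin 3) ℂ) : Prop := ∃ β ≠ 0, ∀ i, β ᵥ* S i = 0

/-- Some linear form on `C` annihilates the pencil. -/
def DegenerateC (S : Fin 2 → Matrix (Fin 3) (Fin 3) ℂ) : Prop := ∃ γ ≠ 0, ∀ i, S i *ᵥ γ = 0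

theorem det_ne_zero_of_not_degenerateB {S : Fin 2 → Matrix (Fin 3) (Fin 3) ℂ}
    {a : Fin 3 → Fin 2 → ℂ} {b c : Fin 3 → Fin 3 → ℂ}
    (h : ∀ i j k, S i j k = ∑ r, a r i * (b r j * c r k)) (hS : ¬ DegenerateB S) :
    (Matrix.of b).det ≠ 0 := by
  intro hb
  obtain ⟨β, hβ, h1⟩ := Matrix.exists_vecMul_eq_zero_iff.2 ((Matrix.det_transpose _).trans hb)
  refine hS ⟨β, hβ, fun i => ?_⟩
  rw [slice_eq_of_sum_three h, ← Matrix.vecMul_vecMul, ← Matrix.vecMul_vecMul, h1]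
  simp

theorem det_ne_zero_of_not_degenerateC {S : Fin 2 → Matrix (Fin 3) (Fin 3) ℂ}
    {a : Fin 3 → Fin 2 → ℂ} {b c : Fin 3 → Fin 3 → ℂ}
    (h : ∀ i j k, S i j k = ∑ r, a r i * (b r j * c r k)) (hS : ¬ DegenerateC S) :
    (Matrix.of c).det ≠ 0 := by
  intro hc
  obtain ⟨γ, hγ, h1⟩ := Matrix.exists_mulVec_eq_zero_iff.2 hc
  refine hS ⟨γ, hγ, fun i => ?_⟩
  rw [slice_eq_of_sum_three h, ← Matrix.mulVec_mulVec, h1]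
  simp

/-- A Jordan chain of length two obstructs being a sum of three decomposable tensors. -/
theorem degenerateB_of_jordan {S : Fin 2 → Matrix (Fin 3) (Fin 3) ℂ} (h : ArrayRankLE 3 S)
    {x y : Fin 3 → ℂ} (h1 : S 1 *ᵥ y = 0) (h2 : S 1 *ᵥ x = S 0 *ᵥ y) (h3 : S 0 *ᵥ y ≠ 0) :
    DegenerateB S := by
  by_contra hS
  obtain ⟨a, b, c, h⟩ := h
  have hb := det_ne_zero_of_not_degenerateB h hS
  -- Cancelling `bᵀ` on the left leaves diagonal equations in the coordinates `c *ᵥ z`;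
  -- invertibility of `c` plays no role.
  have hinj : Function.Injective ((Matrix.of b)ᵀ *ᵥ ·) :=
    Matrix.mulVec_injective_of_isUnit ((Matrix.isUnit_iff_isUnit_det _).2
      (by rw [Matrix.det_transpose]; exact hb.isUnit))
  have h0 : ∀ i z, S i *ᵥ z = (Matrix.of b)ᵀ *ᵥ (fun r => a r i * (Matrix.of c *ᵥ z) r) := by
    intro i z
    rw [slice_eq_of_sum_three h, ← Matrix.mulVec_mulVec, ← Matrix.mulVec_mulVec]
    congr 1
    ext r
    simp [Matrix.mulVec_diagonal]
  rw [h0] at h1 h3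
  rw [h0, h0] at h2
  have h1' := hinj (h1.trans (Matrix.mulVec_zero _).symm)
  have h2' := hinj h2
  refine h3 ((congrArg _ (funext fun r => ?_)).trans (Matrix.mulVec_zero _))
  have e1 := congrFun h1' r
  have e2 := congrFun h2' r
  simp only [Pi.zero_apply, mul_eq_zero] at e1 e2 ⊢
  -- A diagonal pencil has no Jordan chain: if `a r 1 = 0`, then `h2` forces `a r 0 * (c y) r = 0`;
  -- otherwise `(c y) r = 0` already.
  rcases e1 with e1 | e1
  · rw [e1, zero_mul] at e2
    simpa using e2.symm
  · exact Or.inr e1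

/-! ### Arrays of size `2 × 2 × 3` -/

theorem exists_relation (W : Fin 2 → Fin 2 → Fin 3 → ℂ) :
    ∃ f : Fin 2 × Fin 2 → ℂ, f ≠ 0 ∧ ∀ k, ∑ p, f p * W p.1 p.2 k = 0 := by
  let φ : (Fin 2 × Fin 2 → ℂ) →ₗ[ℂ] (Fin 3 → ℂ) := Fintype.linearCombination ℂ fun p k => W p.1 p.2 k
  obtain ⟨f, hf, h⟩ := (Submodule.ne_bot_iff _).1
    (LinearMap.ker_ne_bot_of_finrank_lt (f := φ) (by simp))
  refine ⟨f, h, fun k => ?_⟩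
  have := congrFun (LinearMap.mem_ker.1 hf) k
  simpa [φ, Fintype.linearCombination_apply] using this

/-- The `2 × 2` matrices `W · · k` lie in the hyperplane `x₀₀ + s x₀₁ + t x₁₀ + m x₁₁ = 0`, which is
spanned by three rank-one matrices `p r ⊗ q r`. The first two have `x₁₁ = 0`; the third lies in the
hyperplane with `x₁₁ = 1`, also when `m = s * t`. -/
theorem rank_two_two_three_aux (W : Fin 2 → Fin 2 → Fin 3 → ℂ) (s t m : ℂ)
    (h : ∀ k, W 0 0 k = -(s * W 0 1 k + t * W 1 0 k + m * W 1 1 k)) :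
    ∃ (p q : Fin 3 → Fin 2 → ℂ) (c : Fin 3 → Fin 3 → ℂ),
      ∀ i j k, W i j k = ∑ r, p r i * (q r j * c r k) := by
  refine ⟨![![1, 0], ![-t, 1], ![1 - t, 1]], ![![-s, 1], ![1, 0], ![-(m - s * t) - s, 1]],
    ![fun k => W 0 1 k + t * W 1 1 k - W 1 1 k,
      fun k => W 1 0 k + s * W 1 1 k + (m - s * t) * W 1 1 k, W 1 1], fun i j k => ?_⟩
  fin_cases i <;> fin_cases j <;> simp [Fin.sum_univ_three, h] <;> ring

theorem rank_two_two_three (W : Fin 2 → Fin 2 → Fin 3 → ℂ) :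
    ∃ (p q : Fin 3 → Fin 2 → ℂ) (c : Fin 3 → Fin 3 → ℂ),
      ∀ i j k, W i j k = ∑ r, p r i * (q r j * c r k) := by
  obtain ⟨f, hf, h⟩ := exists_relation W
  obtain ⟨⟨i₀, j₀⟩, h0⟩ := Function.ne_iff.1 hf
  simp only [Pi.zero_apply] at h0
  -- Shifting indices modulo 2 moves a nonzero coefficient of the relation to position `(0, 0)`; the
  -- shift is its own inverse.
  have hinv : ∀ x y : Fin 2, x + y + y = x := by decide
  obtain ⟨p, q, c, hpq⟩ := rank_two_two_three_aux (fun i j => W (i + i₀) (j + j₀))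
    (f (i₀, 1 + j₀) / f (i₀, j₀)) (f (1 + i₀, j₀) / f (i₀, j₀))
    (f (1 + i₀, 1 + j₀) / f (i₀, j₀)) (fun k => by
      have h1 := h k
      rw [Fintype.sum_prod_type] at h1
      simp only [Fin.sum_univ_two] at h1
      field_simp
      fin_cases i₀ <;> fin_cases j₀ <;> simp at h1 ⊢ <;> linear_combination h1)
  refine ⟨fun r i => p r (i + i₀), fun r j => q r (j + j₀), c, fun i j k => ?_⟩
  have := hpq (i + i₀) (j + j₀) k
  simpa only [hinv] using this

/-- Solve for an entry at which `β` is nonzero: `m` lists the two other indices, and `b` is the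
basis of the plane `β = 0` dual to these entries. -/
theorem exists_coordinates {β : Fin 3 → ℂ} (h : β ≠ 0) :
    ∃ (m : Fin 2 → Fin 3) (b : Fin 2 → Fin 3 → ℂ),
      (∀ s, β ⬝ᵥ b s = 0) ∧
        ∀ x : Fin 3 → ℂ, β ⬝ᵥ x = 0 → ∀ j, x j = ∑ s, b s j * x (m s) := by
  obtain ⟨j₀, hj⟩ := Function.ne_iff.1 h
  simp only [Pi.zero_apply] at hj
  fin_cases j₀ <;> simp at hj
  · refine ⟨![1, 2], ![![-β 1 / β 0, 1, 0], ![-β 2 / β 0, 0, 1]],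
      Fin.forall_fin_two.2 ⟨?_, ?_⟩, fun x hx j => ?_⟩
    · simp [dotProduct, Fin.sum_univ_three]; field_simp; ring
    · simp [dotProduct, Fin.sum_univ_three]; field_simp; ring
    simp only [dotProduct, Fin.sum_univ_three] at hx
    fin_cases j <;> simp [Fin.sum_univ_two]
    field_simp
    linear_combination hx
  · refine ⟨![0, 2], ![![1, -β 0 / β 1, 0], ![0, -β 2 / β 1, 1]],
      Fin.forall_fin_two.2 ⟨?_, ?_⟩, fun x hx j => ?_⟩
    · simp [dotProduct, Fin.sum_univ_three]; field_simp; ring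
    · simp [dotProduct, Fin.sum_univ_three]; field_simp; ring
    simp only [dotProduct, Fin.sum_univ_three] at hx
    fin_cases j <;> simp [Fin.sum_univ_two]
    field_simp
    linear_combination hx
  · refine ⟨![0, 1], ![![1, 0, -β 0 / β 2], ![0, 1, -β 1 / β 2]],
      Fin.forall_fin_two.2 ⟨?_, ?_⟩, fun x hx j => ?_⟩
    · simp [dotProduct, Fin.sum_univ_three]; field_simp; ring
    · simp [dotProduct, Fin.sum_univ_three]; field_simp; ring
    simp only [dotProduct, Fin.sum_univ_three] at hx
    fin_cases j <;> simp [Fin.sum_univ_two]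
    field_simp
    linear_combination hx

theorem DegenerateB.arrayRankLE {S : Fin 2 → Matrix (Fin 3) (Fin 3) ℂ} (h : DegenerateB S) :
    ArrayRankLE 3 S := by
  obtain ⟨β, hβ, h⟩ := h
  obtain ⟨m, b, -, hb⟩ := exists_coordinates hβ
  obtain ⟨p, q, c, hc⟩ := rank_two_two_three (fun i s k => S i (m s) k)
  refine ⟨p, fun r j => ∑ s, b s j * q r s, c, fun i j k => ?_⟩
  rw [hb (fun j => S i j k) (congrFun (h i) k) j]
  simp only [hc, Fin.sum_univ_two, Fin.sum_univ_three]
  ring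

theorem DegenerateC.arrayRankLE {S : Fin 2 → Matrix (Fin 3) (Fin 3) ℂ} (h : DegenerateC S) :
    ArrayRankLE 3 S := by
  obtain ⟨γ, hγ, h⟩ := h
  have : DegenerateB fun i => (S i)ᵀ :=
    ⟨γ, hγ, fun i => by rw [Matrix.vecMul_transpose, h i]⟩
  obtain ⟨a, b, c, hc⟩ := this.arrayRankLE
  refine ⟨a, c, b, fun i j k => ?_⟩
  refine (hc i k j).trans ?_
  exact Finset.sum_congr rfl fun r _ => by ring

/-! ### Pencils without double root -/

theorem exists_cubic_roots {a b c d : ℂ} (ha : a ≠ 0) : ∃ x y z : ℂ,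
    b = -(a * (x + y + z)) ∧ c = a * (x * y + x * z + y * z) ∧ d = -(a * (x * y * z)) := by
  let P : Cubic ℂ := ⟨a, b, c, d⟩
  obtain ⟨x, y, z, h⟩ := (Cubic.splits_iff_roots_eq_three (φ := RingHom.id ℂ) (P := P) ha).1
    (IsAlgClosed.splits _)
  refine ⟨x, y, z, ?_, ?_, ?_⟩
  · have := Cubic.b_eq_three_roots ha h
    simp [P] at this; rw [this]; ring
  · have := Cubic.c_eq_three_roots ha h
    simpa [P] using this
  · have := Cubic.d_eq_three_roots ha h
    simpa [P] using this

/-- Eigenvectors of `K⁻¹ L` for the three distinct eigenvalues form an invertible `Q`, so `K = (K Q)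
Q⁻¹` and `L = (K Q) diag(μ) Q⁻¹`. -/
theorem diagonalize_of_distinct_roots {K L : Matrix (Fin 3) (Fin 3) ℂ} (hK : K.det ≠ 0)
    {μ : Fin 3 → ℂ} (hμ : Function.Injective μ) (h : ∀ r, (L - μ r • K).det = 0) :
    ∃ b c : Fin 3 → Fin 3 → ℂ, (∀ j k, K j k = ∑ r, b r j * c r k) ∧
      ∀ j k, L j k = ∑ r, μ r * (b r j * c r k) := by
  choose v hv0 hv using fun r => Matrix.exists_mulVec_eq_zero_iff.2 (h r)
  have hKu : IsUnit K.det := hK.isUnit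
  have hv' : ∀ r, L *ᵥ v r = μ r • K *ᵥ v r := fun r => by
    have := hv r
    rwa [Matrix.sub_mulVec, Matrix.smul_mulVec, sub_eq_zero] at this
  have hli : LinearIndependent ℂ v :=
    Module.End.eigenvectors_linearIndependent' (Matrix.toLin' (K⁻¹ * L)) μ hμ v fun r => by
      rw [Module.End.hasEigenvector_iff, Module.End.mem_eigenspace_iff]
      refine ⟨?_, hv0 r⟩
      rw [Matrix.toLin'_apply, ← Matrix.mulVec_mulVec, hv', Matrix.mulVec_smul,
        Matrix.mulVec_mulVec, Matrix.nonsing_inv_mul _ hKu, Matrix.one_mulVec]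
  set Q : Matrix (Fin 3) (Fin 3) ℂ := (Matrix.of v)ᵀ with hQ
  have hQu : IsUnit Q.det := by
    rw [← Matrix.isUnit_iff_isUnit_det, ← Matrix.linearIndependent_cols_iff_isUnit]
    exact hli
  have hQQ : Q * Q⁻¹ = 1 := Matrix.mul_nonsing_inv _ hQu
  have hLQ : L * Q = K * Q * Matrix.diagonal μ := by
    ext j r
    rw [Matrix.mul_diagonal, mul_comm]
    exact congrFun (hv' r) j
  refine ⟨fun r j => (K * Q) j r, fun r k => Q⁻¹ r k, fun j k => ?_, fun j k => ?_⟩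
  · rw [← Matrix.mul_apply, Matrix.mul_assoc, hQQ, Matrix.mul_one]
  · have : L = K * Q * Matrix.diagonal μ * Q⁻¹ := by
      rw [← hLQ, Matrix.mul_assoc, hQQ, Matrix.mul_one]
    conv_lhs => rw [this, Matrix.mul_apply]
    exact Finset.sum_congr rfl fun r _ => by rw [Matrix.mul_diagonal]; ring

theorem det_sub_smul_eq (K L : Matrix (Fin 3) (Fin 3) ℂ) (x : ℂ) : (L - x • K).det =
    L.det - x * detPolar L K + x ^ 2 * detPolar K L - x ^ 3 * K.det := by
  have := det_pencil L K 1 (-x)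
  rw [one_smul, neg_smul, ← sub_eq_add_neg] at this
  rw [this]; ring

theorem exists_det_ne_zero {S : Fin 2 → Matrix (Fin 3) (Fin 3) ℂ}
    (h : ∀ α : Fin 2 → ℂ, α ≠ 0 → ¬ DoubleRootAt S α) :
    ∃ u v : ℂ, (u • S 0 + v • S 1).det ≠ 0 := by
  -- A cubic vanishing identically has a double root everywhere. Four of its values suffice to kill
  -- the coefficients of `u³` and `u² v`, which is a double root at `(1, 0)`.
  by_contra! hc
  have h10 := hc 1 0
  have h11 := hc 1 1
  have h12 := hc 1 (-1)
  have h01 := hc 0 1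
  rw [det_pencil] at h10 h11 h12 h01
  have hA : (S 0).det = 0 := by linear_combination h10
  have hB : detPolar (S 0) (S 1) = 0 := by
    linear_combination (1 / 2 : ℂ) * h11 - (1 / 2 : ℂ) * h12 - h01
  refine h ![1, 0] (fun h0 => one_ne_zero (congrFun h0 0)) ⟨by simpa using hA, fun i => ?_⟩
  fin_cases i <;> simp [detPolar_self, hA, hB]

theorem injective_vec_three {x y z : ℂ} (hxy : x ≠ y) (hxz : x ≠ z) (hyz : y ≠ z) :
    Function.Injective ![x, y, z] := by
  intro i j hij
  fin_cases i <;> fin_cases j <;> simp_all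

theorem arrayRankLE_of_not_doubleRootAt {S : Fin 2 → Matrix (Fin 3) (Fin 3) ℂ}
    (h : ∀ α : Fin 2 → ℂ, α ≠ 0 → ¬ DoubleRootAt S α) : ArrayRankLE 3 S := by
  obtain ⟨u, v, hK⟩ := exists_det_ne_zero h
  -- Complete `(u, v)` to a unimodular basis, so that the pencil is spanned by an invertible `K` and
  -- some `L`, and its roots become those of `det (L - t K)`.
  obtain ⟨u', v', huv⟩ : ∃ u' v' : ℂ, u * v' - v * u' = 1 := by
    by_cases hu : u = 0
    · by_cases hv : v = 0
      · simp [hu, hv] at hK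
      · exact ⟨-1 / v, 0, by field_simp; ring⟩
    · exact ⟨0, 1 / u, by field_simp; ring⟩
  set K := u • S 0 + v • S 1 with hKdef
  set L := u' • S 0 + v' • S 1 with hLdef
  have hS0 : S 0 = v' • K - v • L := by
    ext j k
    simp only [hKdef, hLdef, Matrix.add_apply, Matrix.sub_apply, Matrix.smul_apply, smul_eq_mul]
    linear_combination -(S 0 j k) * huv
  have hS1 : S 1 = u • L - u' • K := by
    ext j k
    simp only [hKdef, hLdef, Matrix.add_apply, Matrix.sub_apply, Matrix.smul_apply, smul_eq_mul]
    linear_combination -(S 1 j k) * huv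
  obtain ⟨x, y, z, h2, h1, h0⟩ := exists_cubic_roots (a := -K.det) (b := detPolar K L)
    (c := -detPolar L K) (d := L.det) (neg_ne_zero.2 hK)
  have hdet : ∀ t : ℂ, (L - t • K).det = -K.det * ((t - x) * (t - y) * (t - z)) := fun t => by
    rw [det_sub_smul_eq]; linear_combination t ^ 2 * h2 + t * h1 + h0
  -- Up to sign, the derivative of `det (L - t K)` in `t`; it vanishes at a repeated root.
  have hpol : ∀ t : ℂ, detPolar (L - t • K) K =
      K.det * ((t - x) * (t - y) + (t - x) * (t - z) + (t - y) * (t - z)) := fun t => by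
    have := detPolar_pencil_right L K 1 (-t)
    rw [one_smul, neg_smul, ← sub_eq_add_neg] at this
    rw [this]; linear_combination -h1 - 2 * t * h2
  have hno : ∀ t : ℂ, (L - t • K).det = 0 → detPolar (L - t • K) K ≠ 0 := by
    intro t ht hp
    refine h ![u' - t * u, v' - t * v] ?_ ?_
    · intro h0
      have e0 : u' - t * u = 0 := congrFun h0 0
      have e1 : v' - t * v = 0 := congrFun h0 1
      have : u * (t * v) - v * (t * u) = 1 := by linear_combination huv - u * e1 + v * e0
      apply one_ne_zero (α := ℂ)
      rw [← this]; ring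
    · have e : (![u' - t * u, v' - t * v] : Fin 2 → ℂ) 0 • S 0 +
          (![u' - t * u, v' - t * v] : Fin 2 → ℂ) 1 • S 1 = L - t • K := by
        simp only [hKdef, hLdef, Matrix.cons_val_zero, Matrix.cons_val_one]; module
      -- Euler's relation: the derivative in the direction `L - t K` itself is `3 det (L - t K) =
      -- 0`.
      have hL : detPolar (L - t • K) L = 0 := by
        have e2 := detPolar_add_smul (L - t • K) (L - t • K) 1 K t
        rw [detPolar_self, ht, hp, one_smul, sub_add_cancel] at e2
        simpa using e2
      rw [DoubleRootAt, e]
      refine ⟨ht, Fin.forall_fin_two.2 ⟨?_, ?_⟩⟩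
      · rw [hS0, sub_eq_add_neg (v' • K), ← neg_smul, detPolar_add_smul, hp, hL]; ring
      · rw [hS1, sub_eq_add_neg (u • L), ← neg_smul, detPolar_add_smul, hp, hL]; ring
  have hxy : x ≠ y := by
    rintro rfl; exact hno x (by rw [hdet]; ring) (by rw [hpol]; ring)
  have hxz : x ≠ z := by
    rintro rfl; exact hno x (by rw [hdet]; ring) (by rw [hpol]; ring)
  have hyz : y ≠ z := by
    rintro rfl; exact hno y (by rw [hdet]; ring) (by rw [hpol]; ring)
  obtain ⟨b, c, hb, hc⟩ := diagonalize_of_distinct_roots hK (L := L) (μ := ![x, y, z])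
    (injective_vec_three hxy hxz hyz)
    (by
      intro r
      rw [hdet]
      fin_cases r <;> simp)
  refine ⟨fun r => ![v' - v * ![x, y, z] r, u * ![x, y, z] r - u'], b, c, fun i j k => ?_⟩
  fin_cases i
  · simp only [Fin.zero_eta]
    rw [hS0, Matrix.sub_apply, Matrix.smul_apply, Matrix.smul_apply, hb, hc]
    simp [Fin.sum_univ_three]; ring
  · simp only [Fin.mk_one]
    rw [hS1, Matrix.sub_apply, Matrix.smul_apply, Matrix.smul_apply, hb, hc]
    simp [Fin.sum_univ_three]; ring

theorem slice_apply (T : T233) (i : Fin 2) (j k : Fin 3) : slice T i j k = coord₃ i j k T := rfl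

theorem exists_orthogonal (x y : Fin 3 → ℂ) : ∃ β : Fin 3 → ℂ, β ≠ 0 ∧ β ⬝ᵥ x = 0 ∧ β ⬝ᵥ y = 0 := by
  obtain ⟨β, hβ, h⟩ := Matrix.exists_mulVec_eq_zero_iff.2
    (Matrix.det_eq_zero_of_row_eq_zero (A := Matrix.of ![x, y, 0]) 2 fun j => rfl)
  refine ⟨β, hβ, ?_, ?_⟩
  · rw [dotProduct_comm]; exact congrFun h 0
  · rw [dotProduct_comm]; exact congrFun h 1

/-! ### The dual variety -/

/-- The linear form with given coefficients. -/
noncomputable def dotForm {n : ℕ} (w : Fin n → ℂ) : Module.Dual ℂ (Fin n → ℂ) :=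
  ∑ i, w i • LinearMap.proj i

theorem dotForm_apply {n : ℕ} (w x : Fin n → ℂ) : dotForm w x = w ⬝ᵥ x := by
  simp [dotForm, dotProduct]

theorem dotForm_e {n : ℕ} (w : Fin n → ℂ) (i : Fin n) : dotForm w (e i) = w i := by
  simp [dotForm_apply, e]

theorem dual_apply {n : ℕ} (f : Module.Dual ℂ (Fin n → ℂ)) (x : Fin n → ℂ) :
    f x = (fun i => f (e i)) ⬝ᵥ x := by
  conv_lhs => rw [← sum_smul_e x]
  simp [dotProduct, mul_comm]

theorem dual_coeff_ne_zero {n : ℕ} {f : Module.Dual ℂ (Fin n → ℂ)} (hf : f ≠ 0) :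
    (fun i => f (e i)) ≠ 0 := fun h =>
  hf (LinearMap.ext fun x => by rw [dual_apply, h]; simp)

theorem dotForm_ne_zero {n : ℕ} {w : Fin n → ℂ} (hw : w ≠ 0) : dotForm w ≠ 0 := fun h =>
  hw (funext fun i => by rw [← dotForm_e w i, h]; rfl)

theorem pairing_tmul (α : Module.Dual ℂ (Fin 2 → ℂ)) (β γ : Module.Dual ℂ (Fin 3 → ℂ)) (T : T233) :
    pairing (α ⊗ₜ (β ⊗ₜ γ)) T = ∑ i, α (e i) *
      ((fun j => β (e j)) ⬝ᵥ slice T i *ᵥ fun k => γ (e k)) := by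
  conv_lhs => rw [eq_sum_coord₃ T]
  simp only [pairing, map_sum, map_smul, TensorProduct.map_tmul, LinearMap.id_apply,
    TensorProduct.dualDistrib_apply, smul_eq_mul, dotProduct, Matrix.mulVec, Finset.mul_sum,
    slice_apply]
  exact Finset.sum_congr rfl fun i _ => Finset.sum_congr rfl fun j _ =>
    Finset.sum_congr rfl fun k _ => by ring

theorem pairing_smul (ξ : Module.Dual ℂ (Fin 2 → ℂ) ⊗[ℂ]
    (Module.Dual ℂ (Fin 3 → ℂ) ⊗[ℂ] Module.Dual ℂ (Fin 3 → ℂ))) (c : ℂ) (T : T233) :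
    pairing ξ (c • T) = c * pairing ξ T := by
  simp [pairing]

theorem pairing_add_left (ξ η : Module.Dual ℂ (Fin 2 → ℂ) ⊗[ℂ]
    (Module.Dual ℂ (Fin 3 → ℂ) ⊗[ℂ] Module.Dual ℂ (Fin 3 → ℂ))) (T : T233) :
    pairing (ξ + η) T = pairing ξ T + pairing η T := by
  simp [pairing]

theorem dotProduct_pencil_mulVec (S : Fin 2 → Matrix (Fin 3) (Fin 3) ℂ) (α : Fin 2 → ℂ)
    (β γ : Fin 3 → ℂ) : β ⬝ᵥ (α 0 • S 0 + α 1 • S 1) *ᵥ γ = ∑ i, α i * (β ⬝ᵥ S i *ᵥ γ) := by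
  simp [Matrix.add_mulVec, Matrix.smul_mulVec, dotProduct_add, dotProduct_smul]

/-- Varying `x`, `z` and `y` separately in the tangent space gives the three conditions of
`TangentAt`, in this order. -/
theorem tangentAt_iff (α : Module.Dual ℂ (Fin 2 → ℂ)) (β γ : Module.Dual ℂ (Fin 3 → ℂ))
    (T : T233) : (∀ ξ ∈ segreTangent α β γ, pairing ξ T = 0) ↔
      TangentAt (slice T) (fun i => α (e i)) (fun j => β (e j)) (fun k => γ (e k)) := by
  constructor
  · intro h
    refine ⟨fun i => ?_, ?_, ?_⟩
    · have := h _ ⟨dotForm (e i), 0, 0, rfl⟩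
      simp only [TensorProduct.zero_tmul, TensorProduct.tmul_zero, add_zero] at this
      rw [pairing_tmul] at this
      have he : ∀ x, (e i : Fin 2 → ℂ) x = if x = i then 1 else 0 := fun x => by
        simp [e, Pi.single_apply]
      simpa only [dotForm_e, he, ite_mul, one_mul, zero_mul, Finset.sum_ite_eq', Finset.mem_univ,
        if_true] using this
    · have h0 : ∀ z, _ := fun z => h _ ⟨0, 0, dotForm z, rfl⟩
      simp only [TensorProduct.zero_tmul, TensorProduct.tmul_zero, zero_add, pairing_tmul,
        dotForm_e] at h0
      refine dotProduct_eq_zero _ fun z => ?_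
      rw [← Matrix.dotProduct_mulVec]
      exact (dotProduct_pencil_mulVec (slice T) (fun i => α (e i)) _ z).trans (h0 z)
    · have h0 : ∀ y, _ := fun y => h _ ⟨0, dotForm y, 0, rfl⟩
      simp only [TensorProduct.zero_tmul, TensorProduct.tmul_zero, zero_add, add_zero,
        pairing_tmul, dotForm_e] at h0
      refine dotProduct_eq_zero _ fun y => ?_
      rw [dotProduct_comm]
      exact (dotProduct_pencil_mulVec (slice T) (fun i => α (e i)) y _).trans (h0 y)
  · rintro ⟨h1, h2, h3⟩ _ ⟨x, y, z, rfl⟩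
    rw [pairing_add_left, pairing_add_left, pairing_tmul, pairing_tmul, pairing_tmul,
      ← dotProduct_pencil_mulVec (slice T) fun i => α (e i),
      ← dotProduct_pencil_mulVec (slice T) fun i => α (e i), h3, Matrix.dotProduct_mulVec, h2]
    simp [h1]

theorem mk_mem_X₂₃₃Dual {T : T233} (hT : T ≠ 0) {α : Fin 2 → ℂ} {β γ : Fin 3 → ℂ} (hα : α ≠ 0)
    (hβ : β ≠ 0) (hγ : γ ≠ 0) (h : TangentAt (slice T) α β γ) :
    Projectivization.mk ℂ T hT ∈ X₂₃₃Dual := by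
  refine subset_zariskiClosure _ ⟨dotForm α, dotForm β, dotForm γ, dotForm_ne_zero hα,
    dotForm_ne_zero hβ, dotForm_ne_zero hγ, ?_⟩
  obtain ⟨c, -, hc⟩ := exists_rep_eq_smul hT
  intro ξ hξ
  rw [hc, pairing_smul, (tangentAt_iff _ _ _ T).2 (by simpa only [dotForm_e] using h) ξ hξ, mul_zero]

theorem isHomPoly_coord₃ (i : Fin 2) (j k : Fin 3) :
    IsHomPoly 1 (fun T : T233 => slice T i j k) := .linear (coord₃ i j k)

theorem isHomPoly_detPolar (i i' : Fin 2) :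
    IsHomPoly 3 (fun T : T233 => detPolar (slice T i) (slice T i')) := by
  simp only [detPolar_eq]
  have h := fun j k l m n o p q r s => (isHomPoly_coord₃ i' j k).mul
    (((isHomPoly_coord₃ i l m).mul (isHomPoly_coord₃ i n o)).sub
      ((isHomPoly_coord₃ i p q).mul (isHomPoly_coord₃ i r s)))
  exact ((((((((h _ _ _ _ _ _ _ _ _ _).add (h _ _ _ _ _ _ _ _ _ _)).add
    (h _ _ _ _ _ _ _ _ _ _)).add (h _ _ _ _ _ _ _ _ _ _)).add (h _ _ _ _ _ _ _ _ _ _)).add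
    (h _ _ _ _ _ _ _ _ _ _)).add (h _ _ _ _ _ _ _ _ _ _)).add (h _ _ _ _ _ _ _ _ _ _)).add
    (h _ _ _ _ _ _ _ _ _ _)

theorem isHomPoly_det (i : Fin 2) : IsHomPoly 3 (fun T : T233 => (slice T i).det) :=
  .det fun j k => isHomPoly_coord₃ i j k

theorem isHomPoly_pencilDisc : IsHomPoly 12 (fun T : T233 => pencilDisc (slice T)) := by
  have A := isHomPoly_det 0
  have B := isHomPoly_detPolar 0 1
  have C := isHomPoly_detPolar 1 0
  have D := isHomPoly_det 1
  exact (((((B.pow 2).mul (C.pow 2)).sub ((A.mul (C.pow 3)).const_mul 4)).sub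
    (((B.pow 3).mul D).const_mul 4)).sub (((A.pow 2).mul (D.pow 2)).const_mul 27)).add
    (((A.mul B).mul (C.mul D)).const_mul 18)

theorem pencilDisc_eq_zero_of_mem {T : T233} (hT : T ≠ 0)
    (h : Projectivization.mk ℂ T hT ∈ X₂₃₃Dual) : pencilDisc (slice T) = 0 := by
  refine isHomPoly_pencilDisc.eq_zero_of_mem_zariskiClosure ?_ hT h
  rintro q ⟨α, β, γ, hα, hβ, hγ, hq⟩
  exact (((tangentAt_iff _ _ _ _).1 hq).doubleRootAt (dual_coeff_ne_zero hβ)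
    (dual_coeff_ne_zero hγ)).pencilDisc_eq_zero (dual_coeff_ne_zero hα)

/-! ### Secant varieties -/

theorem det_eq_zero_of_sum_two {b c : Fin 2 → Fin 3 → ℂ} {M : Matrix (Fin 3) (Fin 3) ℂ}
    (h : ∀ j k, M j k = ∑ r, b r j * c r k) : M.det = 0 := by
  obtain ⟨β, hβ, h0, h1⟩ := exists_orthogonal (b 0) (b 1)
  refine Matrix.exists_vecMul_eq_zero_iff.1 ⟨β, hβ, funext fun k => ?_⟩
  simp only [dotProduct, Fin.sum_univ_three] at h0 h1
  simp only [Matrix.vecMul, dotProduct, Fin.sum_univ_three, h, Fin.sum_univ_two, Pi.zero_apply]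
  linear_combination c 0 k * h0 + c 1 k * h1

/-- If no `β` kills the pencil, the six columns of its slices span `ℂ³`, so fixed combinations of
them, with coefficients `w`, form the identity matrix. The determinant of these combinations is a
cubic form equal to 1 at `T`, but zero at rank at most 2, where all columns lie in a plane. -/
theorem degenerateB_of_mem_σ₂X₂₃₃ {T : T233} (hT : T ≠ 0)
    (h : Projectivization.mk ℂ T hT ∈ σ₂X₂₃₃) : DegenerateB (slice T) := by
  by_contra hB
  let φ : (Fin 2 × Fin 3 → ℂ) →ₗ[ℂ] (Fin 3 → ℂ) :=
    Fintype.linearCombination ℂ fun p j => slice T p.1 j p.2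
  have hφ : LinearMap.range φ = ⊤ := by
    by_contra hne
    obtain ⟨f, hf, hle⟩ := Submodule.exists_le_ker_of_lt_top _ (lt_top_iff_ne_top.2 hne)
    refine hB ⟨_, dual_coeff_ne_zero hf, fun i => funext fun k => ?_⟩
    have h1 : f (φ (Pi.single (i, k) 1)) = 0 := hle ⟨_, rfl⟩
    rw [dual_apply] at h1
    rw [Fintype.linearCombination_apply_single, one_smul] at h1
    exact h1
  choose w hw using fun l : Fin 3 => LinearMap.range_eq_top.1 hφ (e l)
  have hF : IsHomPoly 3 (fun S : T233 =>
      (Matrix.of fun j l => (∑ p, w l p • coord₃ p.1 j p.2) S).det) :=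
    .det fun j l => .linear _
  have h0 := hF.eq_zero_of_mem_zariskiClosure (fun q hq => ?_) hT h
  · have h1 : (Matrix.of fun j l => (∑ p, w l p • coord₃ p.1 j p.2) T) = 1 := by
      ext j l
      have := congrFun (hw l) j
      simp only [φ, Fintype.linearCombination_apply, Finset.sum_apply, Pi.smul_apply] at this
      simpa [e, Pi.single_apply, Matrix.one_apply, slice_apply] using this
    rw [h1, Matrix.det_one] at h0
    exact one_ne_zero h0
  · obtain ⟨a, b, c, habc⟩ := (tensorRank_le_iff 2 q.rep).1 hq
    refine det_eq_zero_of_sum_two (b := b)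
      (c := fun r l => ∑ p, w l p * (a r p.1 * c r p.2)) fun j l => ?_
    simp only [habc, Matrix.of_apply, LinearMap.sum_apply, LinearMap.smul_apply, map_sum,
      coord₃_tmul, coord₂_tmul, smul_eq_mul, Finset.mul_sum]
    refine Finset.sum_congr rfl fun r _ => ?_
    refine Finset.sum_congr rfl fun p _ => ?_
    ring

theorem det_eq_zero_of_mem_σ₂X₃₃ {M : (Fin 3 → ℂ) ⊗[ℂ] (Fin 3 → ℂ)} (hM : M ≠ 0)
    (h : Projectivization.mk ℂ M hM ∈ σ₂X₃₃) : (toMat M).det = 0 := by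
  have hF : IsHomPoly 3 (fun M => (toMat M).det) := .det fun j k => .linear (coord₂ j k)
  refine hF.eq_zero_of_mem_zariskiClosure (fun q hq => ?_) hM h
  obtain ⟨b, c, hbc⟩ := (simple₂_rankWrt_le_iff 2 q.rep).1 hq
  exact det_eq_zero_of_sum_two (b := b) (c := c) fun j k => by simp [toMat, hbc]

theorem exists_sum_two {M : (Fin 3 → ℂ) ⊗[ℂ] (Fin 3 → ℂ)} (h : (toMat M).det = 0) :
    ∃ b c : Fin 2 → Fin 3 → ℂ, M = b 0 ⊗ₜ c 0 + b 1 ⊗ₜ c 1 := by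
  obtain ⟨β, hβ, h0⟩ := Matrix.exists_vecMul_eq_zero_iff.2 h
  obtain ⟨m, b, -, hb⟩ := exists_coordinates hβ
  refine ⟨b, fun s k => toMat M (m s) k, ext_coord₂ fun j k => ?_⟩
  have := hb (fun j => toMat M j k) (congrFun h0 k) j
  simpa [toMat, Fin.sum_univ_two] using this

theorem mk_mem_σ₂X₃₃ {b₂ c₂ b₃ c₃ : Fin 3 → ℂ} (h : b₂ ⊗ₜ[ℂ] c₂ + b₃ ⊗ₜ[ℂ] c₃ ≠ 0) :
    Projectivization.mk ℂ (b₂ ⊗ₜ[ℂ] c₂ + b₃ ⊗ₜ[ℂ] c₃) h ∈ σ₂X₃₃ := by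
  refine subset_zariskiClosure _ ((simple₂_rankWrt_le_iff _ _).2 ?_)
  obtain ⟨c, -, hc⟩ := exists_rep_eq_smul h
  exact ⟨![c • b₂, c • b₃], ![c₂, c₃], by simp [hc, TensorProduct.smul_tmul']⟩

/-! ### Subspace varieties -/

theorem mk_mem_projectivize_iff {V : Type*} [AddCommGroup V] [Module ℂ V] {S : Set V}
    (hS : ∀ (c : ℂ), ∀ v ∈ S, c • v ∈ S) {v : V} (hv : v ≠ 0) :
    Projectivization.mk ℂ v hv ∈ projectivize S ↔ v ∈ S := by
  constructor
  · rintro ⟨w, hw, hwS, h⟩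
    obtain ⟨c, rfl⟩ := (Projectivization.mk_eq_mk_iff' ℂ _ _ hv hw).1 h
    exact hS c w hwS
  · exact fun h => ⟨v, hv, h, rfl⟩

theorem mk_mem_Sub₂₃₃_iff {m₁ m₂ m₃ : ℕ} {T : T233} (hT : T ≠ 0) :
    Projectivization.mk ℂ T hT ∈ Sub₂₃₃ m₁ m₂ m₃ ↔
      ∃ (A' : Submodule ℂ (Fin 2 → ℂ)) (B' : Submodule ℂ (Fin 3 → ℂ))
        (C' : Submodule ℂ (Fin 3 → ℂ)),
        Module.finrank ℂ A' = m₁ ∧ Module.finrank ℂ B' = m₂ ∧ Module.finrank ℂ C' = m₃ ∧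
        T ∈ LinearMap.range
          (TensorProduct.map A'.subtype (TensorProduct.map B'.subtype C'.subtype)) := by
  refine mk_mem_projectivize_iff (fun c v => ?_) hT
  rintro ⟨A', B', C', h1, h2, h3, h⟩
  exact ⟨A', B', C', h1, h2, h3, Submodule.smul_mem _ _ h⟩

theorem range_map_le {A' : Submodule ℂ (Fin 2 → ℂ)} {B' C' : Submodule ℂ (Fin 3 → ℂ)}
    {W : Submodule ℂ T233}
    (h : ∀ a ∈ A', ∀ b ∈ B', ∀ c ∈ C', a ⊗ₜ[ℂ] (b ⊗ₜ[ℂ] c) ∈ W) :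
    LinearMap.range (TensorProduct.map A'.subtype (TensorProduct.map B'.subtype C'.subtype)) ≤
      W := by
  rintro _ ⟨X, rfl⟩
  induction X using TensorProduct.induction_on with
  | zero => simp
  | add x y hx hy => rw [map_add]; exact W.add_mem hx hy
  | tmul a Y =>
    induction Y using TensorProduct.induction_on with
    | zero => simp
    | add x y hx hy => rw [TensorProduct.tmul_add, map_add]; exact W.add_mem hx hy
    | tmul b c => exact h a a.2 b b.2 c c.2

theorem exists_dual_of_finrank_eq_two {B' : Submodule ℂ (Fin 3 → ℂ)}
    (h : Module.finrank ℂ B' = 2) :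
    ∃ β : Fin 3 → ℂ, β ≠ 0 ∧ ∀ b ∈ B', β ⬝ᵥ b = 0 := by
  obtain ⟨f, hf, hle⟩ := Submodule.exists_le_ker_of_lt_top B' (lt_top_iff_ne_top.2 fun h' => by
    rw [h', finrank_top] at h; simp at h)
  exact ⟨_, dual_coeff_ne_zero hf, fun b hb => by rw [← dual_apply]; exact hle hb⟩

theorem finrank_ker_dotForm {β : Fin 3 → ℂ} (h : β ≠ 0) :
    Module.finrank ℂ (LinearMap.ker (dotForm β)) = 2 := by
  have := Module.Dual.finrank_ker_add_one_of_ne_zero (dotForm_ne_zero h)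
  simpa using this

/-- The subspaces of dimensions 2 and 3 in the outer factors are everything, so only the plane `B'`
matters, and a plane is the kernel of a form `β`. -/
theorem mk_mem_Sub₂₂₃_iff {T : T233} (hT : T ≠ 0) :
    Projectivization.mk ℂ T hT ∈ Sub₂₃₃ 2 2 3 ↔ DegenerateB (slice T) := by
  rw [mk_mem_Sub₂₃₃_iff]
  constructor
  · rintro ⟨A', B', C', -, h, -, hT⟩
    obtain ⟨β, hβ, hB⟩ := exists_dual_of_finrank_eq_two h
    let W : Submodule ℂ T233 := ⨅ i, ⨅ k, LinearMap.ker (∑ j, β j • coord₃ i j k)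
    have hW : T ∈ W := range_map_le (fun a _ b hb c _ => by
      simp only [W, Submodule.mem_iInf, LinearMap.mem_ker]
      intro i k
      have := hB b hb
      simp only [dotProduct, Fin.sum_univ_three] at this
      simp [Fin.sum_univ_three]
      linear_combination a i * c k * this) hT
    simp only [W, Submodule.mem_iInf, LinearMap.mem_ker] at hW
    exact ⟨β, hβ, fun i => funext fun k => by
      simpa [Matrix.vecMul, dotProduct, slice_apply] using hW i k⟩
  · rintro ⟨β, hβ, h⟩
    obtain ⟨m, b, hb0, hb⟩ := exists_coordinates hβ
    refine ⟨⊤, LinearMap.ker (dotForm β), ⊤, by simp, finrank_ker_dotForm hβ, by simp, ?_⟩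
    have : T = ∑ i, ∑ s, ∑ k, slice T i (m s) k • (e i ⊗ₜ[ℂ] (b s ⊗ₜ[ℂ] e k)) :=
      ext_coord₃ fun i j k => by
        have := hb (fun j => slice T i j k) (congrFun (h i) k) j
        simp only [← slice_apply, this]
        simp [slice_apply, e, Pi.single_apply, mul_comm]
        fin_cases i <;> simp
    rw [this]
    exact Submodule.sum_mem _ fun i _ => Submodule.sum_mem _ fun s _ => Submodule.sum_mem _
      fun k _ => Submodule.smul_mem _ _ ⟨⟨e i, trivial⟩ ⊗ₜ (⟨b s, by
        rw [LinearMap.mem_ker, dotForm_apply, hb0]⟩ ⊗ₜ ⟨e k, trivial⟩), rfl⟩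

theorem mk_mem_Sub₂₃₂_iff {T : T233} (hT : T ≠ 0) :
    Projectivization.mk ℂ T hT ∈ Sub₂₃₃ 2 3 2 ↔ DegenerateC (slice T) := by
  rw [mk_mem_Sub₂₃₃_iff]
  constructor
  · rintro ⟨A', B', C', -, -, h, hT⟩
    obtain ⟨γ, hγ, hC⟩ := exists_dual_of_finrank_eq_two h
    let W : Submodule ℂ T233 := ⨅ i, ⨅ j, LinearMap.ker (∑ k, γ k • coord₃ i j k)
    have hW : T ∈ W := range_map_le (fun a _ b _ c hc => by
      simp only [W, Submodule.mem_iInf, LinearMap.mem_ker]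
      intro i j
      have := hC c hc
      simp only [dotProduct, Fin.sum_univ_three] at this
      simp [Fin.sum_univ_three]
      linear_combination a i * b j * this) hT
    simp only [W, Submodule.mem_iInf, LinearMap.mem_ker] at hW
    exact ⟨γ, hγ, fun i => funext fun j => by
      simpa [Matrix.mulVec, dotProduct, slice_apply, mul_comm] using hW i j⟩
  · rintro ⟨γ, hγ, h⟩
    obtain ⟨m, c, hc0, hc⟩ := exists_coordinates hγ
    refine ⟨⊤, ⊤, LinearMap.ker (dotForm γ), by simp, by simp, finrank_ker_dotForm hγ, ?_⟩
    have : T = ∑ i, ∑ j, ∑ s, slice T i j (m s) • (e i ⊗ₜ[ℂ] (e j ⊗ₜ[ℂ] c s)) :=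
      ext_coord₃ fun i j k => by
        have := hc (fun k => slice T i j k)
          ((dotProduct_comm _ _).trans (congrFun (h i) j)) k
        simp only [← slice_apply, this]
        simp [slice_apply, e, Pi.single_apply, mul_comm]
        fin_cases i <;> simp [Finset.sum_add_distrib]
    rw [this]
    exact Submodule.sum_mem _ fun i _ => Submodule.sum_mem _ fun s _ => Submodule.sum_mem _
      fun k _ => Submodule.smul_mem _ _ ⟨⟨e i, trivial⟩ ⊗ₜ (⟨e s, trivial⟩ ⊗ₜ ⟨c k, by
        rw [LinearMap.mem_ker, dotForm_apply, hc0]⟩), rfl⟩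

/-! ### The join -/

theorem exists_of_mem_J₀ {T : T233} (hT : T ≠ 0) (h : Projectivization.mk ℂ T hT ∈ J₀) :
    ∃ (a₁ a : Fin 2 → ℂ) (b c : Fin 3 → Fin 3 → ℂ),
      T = a ⊗ₜ[ℂ] (b 0 ⊗ₜ[ℂ] c 0 + b 1 ⊗ₜ[ℂ] c 1) + a₁ ⊗ₜ[ℂ] (b 2 ⊗ₜ[ℂ] c 2) := by
  obtain ⟨x, ⟨P, hP, ⟨a₁, b₁, c₁, rfl⟩, rfl⟩, y, ⟨Q, hQ, ⟨a, M, hM, hMσ, rfl⟩, rfl⟩, -, hle⟩ := h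
  obtain ⟨b, c, rfl⟩ := exists_sum_two (det_eq_zero_of_mem_σ₂X₃₃ hM hMσ)
  simp only [Projectivization.submodule_mk] at hle
  obtain ⟨y, hy, z, hz, hT'⟩ := Submodule.mem_sup.1 (hle (Submodule.mem_span_singleton_self T))
  obtain ⟨s, rfl⟩ := Submodule.mem_span_singleton.1 hy
  obtain ⟨t, rfl⟩ := Submodule.mem_span_singleton.1 hz
  refine ⟨s • a₁, t • a, ![b 0, b 1, b₁], ![c 0, c 1, c₁], ?_⟩
  rw [← hT', add_comm]
  simp [TensorProduct.smul_tmul']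

theorem degenerateB_of_eq_tmul {T : T233} {a : Fin 2 → ℂ} {b₂ c₂ b₃ c₃ : Fin 3 → ℂ}
    (h : T = a ⊗ₜ[ℂ] (b₂ ⊗ₜ[ℂ] c₂ + b₃ ⊗ₜ[ℂ] c₃)) : DegenerateB (slice T) := by
  obtain ⟨β, hβ, h0, h1⟩ := exists_orthogonal b₂ b₃
  refine ⟨β, hβ, fun i => funext fun k => ?_⟩
  simp only [dotProduct, Fin.sum_univ_three] at h0 h1
  simp [Matrix.vecMul, dotProduct, Fin.sum_univ_three, slice_apply, h]
  linear_combination a i * c₂ k * h0 + a i * c₃ k * h1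

/-- The open join needs two nonzero summands giving distinct points. If this failed, `T` would be a
single `a ⊗ M` with `M` of rank at most 2, hence degenerate. -/
theorem mk_mem_J₀ {T : T233} (hT : T ≠ 0) (hB : ¬ DegenerateB (slice T)) {a₁ a : Fin 2 → ℂ}
    {b₁ c₁ b₂ c₂ b₃ c₃ : Fin 3 → ℂ}
    (h : T = a ⊗ₜ[ℂ] (b₂ ⊗ₜ[ℂ] c₂ + b₃ ⊗ₜ[ℂ] c₃) + a₁ ⊗ₜ[ℂ] (b₁ ⊗ₜ[ℂ] c₁)) :
    Projectivization.mk ℂ T hT ∈ J₀ := by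
  have hP : a₁ ⊗ₜ[ℂ] (b₁ ⊗ₜ[ℂ] c₁) ≠ 0 := fun h0 =>
    hB (degenerateB_of_eq_tmul (by rw [h, h0, add_zero]))
  have hQ : a ⊗ₜ[ℂ] (b₂ ⊗ₜ[ℂ] c₂ + b₃ ⊗ₜ[ℂ] c₃) ≠ 0 := fun h0 =>
    hB (degenerateB_of_eq_tmul (a := a₁) (b₂ := b₁) (c₂ := c₁) (b₃ := 0) (c₃ := 0) (by
      rw [h, h0]; simp))
  have hM : b₂ ⊗ₜ[ℂ] c₂ + b₃ ⊗ₜ[ℂ] c₃ ≠ 0 := fun h0 => hQ (by rw [h0, TensorProduct.tmul_zero])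
  refine ⟨Projectivization.mk ℂ _ hP, ⟨_, hP, ⟨_, _, _, rfl⟩, rfl⟩, Projectivization.mk ℂ _ hQ,
    ⟨_, hQ, ⟨_, _, hM, mk_mem_σ₂X₃₃ hM, rfl⟩, rfl⟩, fun heq => ?_, ?_⟩
  · obtain ⟨c, hc⟩ := (Projectivization.mk_eq_mk_iff' ℂ _ _ hP hQ).1 heq
    refine hB (degenerateB_of_eq_tmul (a := (1 + c) • a) (b₂ := b₂) (c₂ := c₂) (b₃ := b₃)
      (c₃ := c₃) ?_)
    rw [h, ← hc, ← TensorProduct.smul_tmul', add_smul, one_smul]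
  · simp only [Projectivization.submodule_mk]
    rw [Submodule.span_singleton_le_iff_mem, h, add_comm (_ ⊗ₜ[ℂ] (_ + _))]
    exact Submodule.add_mem_sup (Submodule.mem_span_singleton_self _)
      (Submodule.mem_span_singleton_self _)

/-! ### Tensors of maximal rank -/

theorem arrayRankLE_of_mem_J₀ {T : T233} (hT : T ≠ 0) (h : Projectivization.mk ℂ T hT ∈ J₀) :
    ArrayRankLE 3 (slice T) := by
  obtain ⟨a₁, a, b, c, rfl⟩ := exists_of_mem_J₀ hT h
  refine (tensorRank_le_iff_slice _ _).1 ((tensorRank_le_iff _ _).2 ⟨![a, a, a₁], b, c, ?_⟩)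
  simp [Fin.sum_univ_three, TensorProduct.tmul_add]

theorem exists_smul_of_parallel {x y : Fin 2 → ℂ} (hx : x ≠ 0) (h : x 0 * y 1 = x 1 * y 0) :
    ∃ s : ℂ, y = s • x := by
  obtain ⟨i, hi⟩ := Function.ne_iff.1 hx
  refine ⟨y i / x i, funext (Fin.forall_fin_two.2 ?_)⟩
  simp only [Pi.zero_apply] at hi
  fin_cases i
  · replace hi : x 0 ≠ 0 := hi
    refine ⟨(div_mul_cancel₀ (y 0) hi).symm, ?_⟩
    simp only [Fin.zero_eta, Pi.smul_apply, smul_eq_mul]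
    field_simp
    linear_combination h
  · replace hi : x 1 ≠ 0 := hi
    refine ⟨?_, (div_mul_cancel₀ (y 1) hi).symm⟩
    simp only [Fin.mk_one, Pi.smul_apply, smul_eq_mul]
    field_simp
    linear_combination -h

theorem mk_mem_J₀_of_parallel {T : T233} (hT : T ≠ 0) (hB : ¬ DegenerateB (slice T))
    {x y z : Fin 2 → ℂ} {b c : Fin 3 → Fin 3 → ℂ}
    (h : T = x ⊗ₜ[ℂ] (b 0 ⊗ₜ[ℂ] c 0) + y ⊗ₜ[ℂ] (b 1 ⊗ₜ[ℂ] c 1) + z ⊗ₜ[ℂ] (b 2 ⊗ₜ[ℂ] c 2))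
    (hxy : x 0 * y 1 = x 1 * y 0) : Projectivization.mk ℂ T hT ∈ J₀ := by
  by_cases hx : x = 0
  · refine mk_mem_J₀ hT hB (a := y) (a₁ := z) (b₁ := b 2) (c₁ := c 2) (b₂ := b 1) (c₂ := c 1)
      (b₃ := 0) (c₃ := 0) ?_
    rw [h, hx]; simp
  · obtain ⟨s, rfl⟩ := exists_smul_of_parallel hx hxy
    refine mk_mem_J₀ hT hB (a := x) (a₁ := z) (b₁ := b 2) (c₁ := c 2) (b₂ := b 0) (c₂ := c 0)
      (b₃ := s • b 1) (c₃ := c 1) ?_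
    rw [h, TensorProduct.tmul_add, TensorProduct.smul_tmul, TensorProduct.smul_tmul']

/-- The tensors of rank at least four. -/
theorem four_le_tensorRank_iff (T : T233) : 4 ≤ tensorRank T ↔
    ∃ h : T ≠ 0, Projectivization.mk ℂ T h ∈
      X₂₃₃Dual \ (σ₂X₂₃₃ ∪ Sub₂₃₃ 2 2 3 ∪ Sub₂₃₃ 2 3 2 ∪ J₀) := by
  rw [← not_lt, Nat.lt_succ_iff, tensorRank_le_iff_slice]
  constructor
  · intro h
    have hT : T ≠ 0 := by
      rintro rfl
      exact h ⟨0, 0, 0, fun i j k => by simp [slice_apply]⟩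
    refine ⟨hT, ?_, ?_⟩
    · by_contra hX
      refine h (arrayRankLE_of_not_doubleRootAt fun α hα hd => ?_)
      obtain ⟨β, γ, hβ, hγ, ht⟩ := hd.exists_tangentAt hα
      exact hX (mk_mem_X₂₃₃Dual hT hα hβ hγ ht)
    · rintro (((h' | h') | h') | h')
      · exact h (degenerateB_of_mem_σ₂X₂₃₃ hT h').arrayRankLE
      · exact h ((mk_mem_Sub₂₂₃_iff hT).1 h').arrayRankLE
      · exact h ((mk_mem_Sub₂₃₂_iff hT).1 h').arrayRankLE
      · exact h (arrayRankLE_of_mem_J₀ hT h')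
  · rintro ⟨hT, hX, hn⟩ ⟨a, b, c, h⟩
    have hB : ¬ DegenerateB (slice T) := fun h' =>
      hn (.inl (.inl (.inr ((mk_mem_Sub₂₂₃_iff hT).2 h'))))
    have hC : ¬ DegenerateC (slice T) := fun h' =>
      hn (.inl (.inr ((mk_mem_Sub₂₃₂_iff hT).2 h')))
    have hJ : Projectivization.mk ℂ T hT ∉ J₀ := fun h' => hn (.inr h')
    have hTs : T = a 0 ⊗ₜ[ℂ] (b 0 ⊗ₜ[ℂ] c 0) + a 1 ⊗ₜ[ℂ] (b 1 ⊗ₜ[ℂ] c 1) +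
        a 2 ⊗ₜ[ℂ] (b 2 ⊗ₜ[ℂ] c 2) := ext_coord₃ fun i j k => by
      rw [← slice_apply, h]; simp [Fin.sum_univ_three]
    rcases exists_parallel h (det_ne_zero_of_not_degenerateB h hB)
      (det_ne_zero_of_not_degenerateC h hC) (pencilDisc_eq_zero_of_mem hT hX) with hp | hp | hp
    · exact hJ (mk_mem_J₀_of_parallel hT hB (b := b) (c := c) hTs hp)
    -- Permute the summands so that the parallel pair comes first.
    · refine hJ (mk_mem_J₀_of_parallel hT hB (x := a 0) (y := a 2) (z := a 1)
        (b := ![b 0, b 2, b 1]) (c := ![c 0, c 2, c 1]) (hTs.trans ?_) hp)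
      simp [add_right_comm]
    · refine hJ (mk_mem_J₀_of_parallel hT hB (x := a 1) (y := a 2) (z := a 0)
        (b := ![b 1, b 2, b 0]) (c := ![c 1, c 2, c 0]) (hTs.trans ?_) hp)
      simp; abel

/-! ### The orbits of rank four -/

theorem slice_pencil_zero (M N : (Fin 3 → ℂ) ⊗[ℂ] (Fin 3 → ℂ)) :
    slice (pencil M N) 0 = toMat M := by
  ext j k; simp [slice_apply, pencil, toMat, e]

theorem slice_pencil_one (M N : (Fin 3 → ℂ) ⊗[ℂ] (Fin 3 → ℂ)) :
    slice (pencil M N) 1 = toMat N := by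
  ext j k; simp [slice_apply, pencil, toMat, e]

theorem toMat_add (M N : (Fin 3 → ℂ) ⊗[ℂ] (Fin 3 → ℂ)) : toMat (M + N) = toMat M + toMat N := by
  ext j k; simp [toMat]

theorem toMat_tmul_mulVec (b c x : Fin 3 → ℂ) : toMat (b ⊗ₜ c) *ᵥ x = (c ⬝ᵥ x) • b := by
  ext j
  simp [toMat, Matrix.mulVec, dotProduct, Finset.sum_mul]
  exact Finset.sum_congr rfl fun _ _ => by ring

theorem vecMul_toMat_tmul (b c x : Fin 3 → ℂ) : x ᵥ* toMat (b ⊗ₜ c) = (x ⬝ᵥ b) • c := by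
  ext j
  simp [toMat, Matrix.vecMul, dotProduct, Finset.sum_mul]
  exact Finset.sum_congr rfl fun _ _ => by ring

theorem dotProduct_e (x : Fin 3 → ℂ) (i : Fin 3) : x ⬝ᵥ e i = x i := by simp [e]

theorem e_apply (i j : Fin 3) : (e i : Fin 3 → ℂ) j = if j = i then 1 else 0 := by
  simp [e, Pi.single_apply]

/-- The four normal forms share the Jordan chain `N e₀ = 0`, `N e₁ = e₀ = M e₀` (indices from 0), so
one argument bounds all their ranks. -/
theorem four_le_tensorRank_pencil {M N : (Fin 3 → ℂ) ⊗[ℂ] (Fin 3 → ℂ)}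
    (h0 : toMat N *ᵥ e 0 = 0) (h1 : toMat N *ᵥ e 1 = e 0) (h2 : toMat M *ᵥ e 0 = e 0)
    (hB : ∀ β : Fin 3 → ℂ, β ᵥ* toMat M = 0 → β ᵥ* toMat N = 0 → β = 0) :
    4 ≤ tensorRank (pencil M N) := by
  rw [← not_lt, Nat.lt_succ_iff, tensorRank_le_iff_slice]
  intro h
  obtain ⟨β, hβ, hd⟩ := degenerateB_of_jordan h (x := e 1) (y := e 0)
    (by rw [slice_pencil_one, h0]) (by rw [slice_pencil_one, slice_pencil_zero, h1, h2])
    (by rw [slice_pencil_zero, h2]; exact fun h => one_ne_zero (α := ℂ) (by simpa [e] using congrFun h 0))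
  refine hβ (hB β ?_ ?_)
  · rw [← slice_pencil_zero M N]; exact hd 0
  · rw [← slice_pencil_one M N]; exact hd 1

theorem four_le_tensorRank_T₁₃ : 4 ≤ tensorRank T₁₃ := by
  refine four_le_tensorRank_pencil ?_ ?_ ?_ fun β hM hN => ?_
  · simp [toMat_add, Matrix.add_mulVec, toMat_tmul_mulVec, dotProduct_e, e_apply]
  · simp [toMat_add, Matrix.add_mulVec, toMat_tmul_mulVec, dotProduct_e, e_apply]
  · simp [toMat_add, Matrix.add_mulVec, toMat_tmul_mulVec, dotProduct_e, e_apply]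
  · simp only [toMat_add, Matrix.vecMul_add, vecMul_toMat_tmul, dotProduct_e] at hM hN
    have m0 := congrFun hM 0
    have m2 := congrFun hM 2
    have n2 := congrFun hN 2
    simp [e_apply] at m0 m2 n2
    ext j; fin_cases j <;> simpa

theorem four_le_tensorRank_T₁₅ : 4 ≤ tensorRank T₁₅ := by
  refine four_le_tensorRank_pencil ?_ ?_ ?_ fun β hM _ => ?_
  · simp [toMat_tmul_mulVec, dotProduct_e, e_apply]
  · simp [toMat_tmul_mulVec, dotProduct_e, e_apply]
  · simp [toMat_add, Matrix.add_mulVec, toMat_tmul_mulVec, dotProduct_e, e_apply]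
  · simp only [toMat_add, Matrix.vecMul_add, vecMul_toMat_tmul, dotProduct_e] at hM
    have m := congrFun hM
    ext j
    have m := m j
    fin_cases j <;> simpa [e_apply] using m

theorem four_le_tensorRank_T₁₆ : 4 ≤ tensorRank T₁₆ := by
  refine four_le_tensorRank_pencil ?_ ?_ ?_ fun β hM _ => ?_
  · simp [toMat_add, Matrix.add_mulVec, toMat_tmul_mulVec, dotProduct_e, e_apply]
  · simp [toMat_add, Matrix.add_mulVec, toMat_tmul_mulVec, dotProduct_e, e_apply]
  · simp [toMat_add, Matrix.add_mulVec, toMat_tmul_mulVec, dotProduct_e, e_apply]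
  · simp only [toMat_add, Matrix.vecMul_add, vecMul_toMat_tmul, dotProduct_e] at hM
    ext j
    have m := congrFun hM j
    fin_cases j <;> simpa [e_apply] using m

theorem four_le_tensorRank_T₁₇ : 4 ≤ tensorRank T₁₇ := by
  refine four_le_tensorRank_pencil ?_ ?_ ?_ fun β hM hN => ?_
  · simp [toMat_add, Matrix.add_mulVec, toMat_tmul_mulVec, dotProduct_e, e_apply]
  · simp [toMat_add, Matrix.add_mulVec, toMat_tmul_mulVec, dotProduct_e, e_apply]
  · simp [toMat_add, Matrix.add_mulVec, toMat_tmul_mulVec, dotProduct_e, e_apply]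
  · simp only [toMat_add, Matrix.vecMul_add, vecMul_toMat_tmul, dotProduct_e] at hM hN
    have m0 := congrFun hM 0
    have m1 := congrFun hM 1
    have n2 := congrFun hN 2
    simp [e_apply] at m0 m1 n2
    ext j; fin_cases j <;> simpa

theorem tensorRank_T₁₃ : tensorRank T₁₃ = 4 := by
  refine le_antisymm ((tensorRank_le_iff _ _).2 ⟨![e 0, e 0, e 1, e 1], ![e 0, e 1, e 0, e 2],
    ![e 0, e 2, e 1, e 2], ?_⟩) four_le_tensorRank_T₁₃
  simp [T₁₃, pencil, Fin.sum_univ_four, TensorProduct.tmul_add, add_assoc]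

theorem tensorRank_T₁₅ : tensorRank T₁₅ = 4 := by
  refine le_antisymm ((tensorRank_le_iff _ _).2 ⟨![e 0, e 0, e 0, e 1], ![e 0, e 1, e 2, e 0],
    ![e 0, e 1, e 2, e 1], ?_⟩) four_le_tensorRank_T₁₅
  simp [T₁₅, pencil, Fin.sum_univ_four, TensorProduct.tmul_add, add_assoc]

theorem tensorRank_T₁₇ : tensorRank T₁₇ = 4 := by
  refine le_antisymm ((tensorRank_le_iff _ _).2 ⟨![e 0, e 0, e 1, e 1], ![e 0, e 1, e 0, e 2],
    ![e 0, e 1, e 1, e 2], ?_⟩) four_le_tensorRank_T₁₇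
  simp [T₁₇, pencil, Fin.sum_univ_four, TensorProduct.tmul_add, add_assoc]

theorem tensorRank_T₁₆ : tensorRank T₁₆ = 4 := by
  -- Adding 1 in row 2, column 1 (from 0) of the `v`-matrix makes it diagonalizable with eigenvalues
  -- `0, 1, -1`: the first three terms use its eigenvectors and their dual basis, and the fourth
  -- undoes the addition.
  refine le_antisymm ((tensorRank_le_iff_slice _ _).2 ⟨![![1, 0], ![1, 1], ![1, -1], ![0, -1]],
    ![![1, 0, 0], ![1, 1, 1], ![1, -1, 1], ![0, 0, 1]],
    ![![1, 0, -1], ![0, 1 / 2, 1 / 2], ![0, -1 / 2, 1 / 2], ![0, 1, 0]], fun i j k => ?_⟩)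
    four_le_tensorRank_T₁₆
  fin_cases i <;> fin_cases j <;> fin_cases k <;>
    simp [T₁₆, slice_pencil_zero, slice_pencil_one, toMat, e_apply, Fin.sum_univ_four] <;> norm_num

theorem tensorRank_eq_four {T : T233}
    (h : T ∈ orbit T₁₃ ∪ orbit T₁₅ ∪ orbit T₁₆ ∪ orbit T₁₇) : tensorRank T = 4 := by
  rcases h with ((h | h) | h) | h
  · rw [tensorRank_eq_of_mem_orbit h, tensorRank_T₁₃]
  · rw [tensorRank_eq_of_mem_orbit h, tensorRank_T₁₅]
  · rw [tensorRank_eq_of_mem_orbit h, tensorRank_T₁₆]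
  · rw [tensorRank_eq_of_mem_orbit h, tensorRank_T₁₇]

theorem mem_forbiddenLocus_iff {T : T233} (h : tensorRank T = 4)
    (p : (Fin 2 → ℂ) × (Fin 3 → ℂ) × (Fin 3 → ℂ)) : p ∈ forbiddenLocus T ↔
      ∀ t : ℂ, 4 ≤ tensorRank (T - t • (p.1 ⊗ₜ[ℂ] (p.2.1 ⊗ₜ[ℂ] p.2.2))) := by
  simp only [forbiddenLocus, decompositionLocus, Set.mem_compl_iff, Set.mem_ofPred_eq, not_exists, h]
  refine forall_congr' fun t => ?_
  -- Adding `t • P` back raises the rank by at most one, so the only alternative to rank at least 4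
  -- is rank exactly 3.
  have h3 : 3 ≤ tensorRank (T - t • (p.1 ⊗ₜ[ℂ] (p.2.1 ⊗ₜ[ℂ] p.2.2))) := by
    by_contra! hlt
    have := tensorRank_add_simple_le (Nat.lt_succ_iff.1 hlt) (t • p.1) p.2.1 p.2.2
    rw [← TensorProduct.smul_tmul', sub_add_cancel, h] at this
    omega
  omega

/-! ### The closure of the join -/

theorem mulVec_e {n : ℕ} (A : Matrix (Fin n) (Fin n) ℂ) (i : Fin n) : A *ᵥ e i = fun j => A j i := by
  ext j; simp [e]

theorem mem_orbit_T₁₄ {a : Matrix (Fin 2) (Fin 2) ℂ} {b c : Matrix (Fin 3) (Fin 3) ℂ}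
    (ha : a.det ≠ 0) (hb : b.det ≠ 0) (hc : c.det ≠ 0) :
    a 0 ⊗ₜ[ℂ] (b 0 ⊗ₜ[ℂ] c 0 + b 1 ⊗ₜ[ℂ] c 1) + a 1 ⊗ₜ[ℂ] (b 2 ⊗ₜ[ℂ] c 2) ∈ orbit T₁₄ := by
  have key : ∀ {n : ℕ} {x : Matrix (Fin n) (Fin n) ℂ}, x.det ≠ 0 →
      ∃ g : (Fin n → ℂ) ≃ₗ[ℂ] (Fin n → ℂ), ∀ i, g (e i) = x i := fun {n x} hx =>
    ⟨Matrix.toLinearEquiv' xᵀ (Matrix.invertibleOfIsUnitDet _ (by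
      rw [Matrix.det_transpose]; exact hx.isUnit)), fun i => by
        change Matrix.toLin' xᵀ (e i) = x i
        rw [Matrix.toLin'_apply, mulVec_e]; rfl⟩
  obtain ⟨g₁, h₁⟩ := key ha
  obtain ⟨g₂, h₂⟩ := key hb
  obtain ⟨g₃, h₃⟩ := key hc
  exact ⟨g₁, g₂, g₃, by simp [T₁₄, pencil, h₁, h₂, h₃]⟩

theorem T₁₄_not_degenerateB : ¬ DegenerateB (slice T₁₄) := by
  rintro ⟨β, hβ, h⟩
  have hM := h 0
  have hN := h 1
  rw [T₁₄, slice_pencil_zero] at hM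
  rw [T₁₄, slice_pencil_one] at hN
  simp only [toMat_add, Matrix.vecMul_add, vecMul_toMat_tmul, dotProduct_e] at hM hN
  have m0 := congrFun hM 0
  have m1 := congrFun hM 1
  have n2 := congrFun hN 2
  simp [e_apply] at m0 m1 n2
  exact hβ (by ext j; fin_cases j <;> simpa)

/-- As a function of `t`, this determinant is the characteristic polynomial of `-A`. -/
theorem finite_det_add_smul_one {n : ℕ} (A : Matrix (Fin n) (Fin n) ℂ) :
    {t : ℂ | (A + t • 1).det = 0}.Finite := by
  have hp : (-A).charpoly ≠ 0 := (Matrix.charpoly_monic _).ne_zero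
  refine (Polynomial.finite_setOfPred_isRoot hp).subset fun t ht => ?_
  rw [Set.mem_ofPred_eq] at ht ⊢
  rw [Polynomial.IsRoot, Matrix.eval_charpoly, ← ht]
  congr 1
  ext i j
  simp [Matrix.scalar_apply, Matrix.one_apply, Matrix.diagonal_apply]
  ring

theorem polyEval_eq_zero_of_orbit {d : ℕ} {f : MvPolynomial (Module.Dual ℂ T233) ℂ}
    (hf : f.IsHomogeneous d) (h : ∀ q ∈ projectivize (orbit T₁₄), polyEval f q.rep = 0)
    {S : T233} (hS : S ∈ orbit T₁₄) : polyEval f S = 0 := by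
  have hS0 : S ≠ 0 := by
    rintro rfl
    obtain ⟨g₁, g₂, g₃, hg⟩ := hS
    have := (LinearEquiv.map_eq_zero_iff _).1 hg.symm
    refine T₁₄_not_degenerateB ⟨e 0, ?_, fun i => ?_⟩
    · exact fun h => one_ne_zero (α := ℂ) (by simpa [e] using congrFun h 0)
    · rw [this]; ext k; simp [Matrix.vecMul, dotProduct, slice_apply]
  rw [← polyEval_mk_rep_eq_zero_iff hf hS0]
  exact h _ ⟨S, hS0, hS, rfl⟩

theorem continuous_polyEval {f : MvPolynomial (Module.Dual ℂ T233) ℂ} {S : ℂ → T233}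
    (hS : ∀ i j k, Continuous fun t => coord₃ i j k (S t)) :
    Continuous fun t => polyEval f (S t) := by
  refine (MvPolynomial.continuous_eval f).comp (continuous_pi fun φ => ?_)
  have : (fun t => φ (S t)) = fun t => ∑ i, ∑ j, ∑ k, coord₃ i j k (S t) *
      φ (e i ⊗ₜ[ℂ] (e j ⊗ₜ[ℂ] e k)) := by
    ext t
    conv_lhs => rw [eq_sum_coord₃ (S t)]
    simp only [map_sum, map_smul, smul_eq_mul]
  rw [this]
  exact continuous_finsetSum _ fun i _ => continuous_finsetSum _ fun j _ =>
    continuous_finsetSum _ fun k _ => (hS i j k).mul continuous_const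

/-- Adding `t • 1` to the three frames makes them invertible for all but finitely many `t`, which
puts the tensor in the orbit. So `f` vanishes on a dense set of `t`, and by continuity at `t = 0`.
-/
theorem polyEval_eq_zero_of_join {d : ℕ} {f : MvPolynomial (Module.Dual ℂ T233) ℂ}
    (hf : f.IsHomogeneous d) (h : ∀ q ∈ projectivize (orbit T₁₄), polyEval f q.rep = 0)
    (a : Matrix (Fin 2) (Fin 2) ℂ) (b c : Matrix (Fin 3) (Fin 3) ℂ) :
    polyEval f (a 0 ⊗ₜ[ℂ] (b 0 ⊗ₜ[ℂ] c 0 + b 1 ⊗ₜ[ℂ] c 1) + a 1 ⊗ₜ[ℂ] (b 2 ⊗ₜ[ℂ] c 2)) = 0 := by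
  let A : ℂ → Matrix (Fin 2) (Fin 2) ℂ := fun t => a + t • 1
  let B : ℂ → Matrix (Fin 3) (Fin 3) ℂ := fun t => b + t • 1
  let C : ℂ → Matrix (Fin 3) (Fin 3) ℂ := fun t => c + t • 1
  let S : ℂ → T233 := fun t => A t 0 ⊗ₜ[ℂ] (B t 0 ⊗ₜ[ℂ] C t 0 + B t 1 ⊗ₜ[ℂ] C t 1) +
    A t 1 ⊗ₜ[ℂ] (B t 2 ⊗ₜ[ℂ] C t 2)
  have hcont : Continuous fun t => polyEval f (S t) := continuous_polyEval fun i j k => by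
    simp only [S, A, B, C, map_add, coord₃_tmul, coord₂_tmul, Matrix.add_apply, Matrix.smul_apply]
    fun_prop
  have hdense := (((finite_det_add_smul_one a).union (finite_det_add_smul_one b)).union
    (finite_det_add_smul_one c)).countable.dense_compl ℂ
  have hzero : (fun t => polyEval f (S t)) = fun _ => 0 :=
    hcont.ext_on hdense continuous_const fun t ht => by
      simp only [Set.mem_compl_iff, Set.mem_union, Set.mem_ofPred_eq, not_or] at ht
      exact polyEval_eq_zero_of_orbit hf h (mem_orbit_T₁₄ ht.1.1 ht.1.2 ht.2)
  simpa [S, A, B, C] using congrFun hzero 0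

/-- In the form of membership in `Sub₂₃₃ 2 2 3`, degeneracy is visibly invariant: map the three
subspaces. -/
theorem DegenerateB.congr {T : T233} (hT : T ≠ 0) (h : DegenerateB (slice T))
    (g₁ : (Fin 2 → ℂ) ≃ₗ[ℂ] (Fin 2 → ℂ)) (g₂ g₃ : (Fin 3 → ℂ) ≃ₗ[ℂ] (Fin 3 → ℂ)) :
    DegenerateB (slice (TensorProduct.congr g₁ (TensorProduct.congr g₂ g₃) T)) := by
  have hS : TensorProduct.congr g₁ (TensorProduct.congr g₂ g₃) T ≠ 0 :=
    (LinearEquiv.map_ne_zero_iff _).2 hT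
  obtain ⟨A', B', C', h1, h2, h3, h⟩ :=
    (mk_mem_Sub₂₃₃_iff hT).1 ((mk_mem_Sub₂₂₃_iff hT).2 h)
  refine (mk_mem_Sub₂₂₃_iff hS).1 ((mk_mem_Sub₂₃₃_iff hS).2
    ⟨A'.map (g₁ : (Fin 2 → ℂ) →ₗ[ℂ] (Fin 2 → ℂ)), B'.map (g₂ : (Fin 3 → ℂ) →ₗ[ℂ] (Fin 3 → ℂ)),
      C'.map (g₃ : (Fin 3 → ℂ) →ₗ[ℂ] (Fin 3 → ℂ)), ?_, ?_, ?_, ?_⟩)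
  · rw [LinearEquiv.finrank_map_eq, h1]
  · rw [LinearEquiv.finrank_map_eq, h2]
  · rw [LinearEquiv.finrank_map_eq, h3]
  · exact range_map_le (W := (LinearMap.range _).comap
      (TensorProduct.congr g₁ (TensorProduct.congr g₂ g₃)).toLinearMap)
      (fun a ha b hb c hc => ⟨⟨g₁ a, Submodule.mem_map_of_mem ha⟩ ⊗ₜ
        (⟨g₂ b, Submodule.mem_map_of_mem hb⟩ ⊗ₜ ⟨g₃ c, Submodule.mem_map_of_mem hc⟩), by simp⟩) h

theorem orbit_T₁₄_subset_J₀ : projectivize (orbit T₁₄) ⊆ J₀ := by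
  rintro _ ⟨S, hS, ⟨g₁, g₂, g₃, rfl⟩, rfl⟩
  refine mk_mem_J₀ hS (fun hB => ?_) (a := g₁ (e 0)) (a₁ := g₁ (e 1)) (b₁ := g₂ (e 2))
    (c₁ := g₃ (e 2)) (b₂ := g₂ (e 0)) (c₂ := g₃ (e 0)) (b₃ := g₂ (e 1)) (c₃ := g₃ (e 1))
    (by simp [T₁₄, pencil])
  refine T₁₄_not_degenerateB ?_
  have := hB.congr hS g₁.symm g₂.symm g₃.symm
  rwa [← TensorProduct.congr_symm, ← TensorProduct.congr_symm,
    LinearEquiv.symm_apply_apply] at this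

theorem zariskiClosure_J₀ :
    zariskiClosure J₀ = zariskiClosure (projectivize (orbit T₁₄)) := by
  refine Set.Subset.antisymm (zariskiClosure_subset fun p hp d f hf h => ?_)
    (zariskiClosure_subset (orbit_T₁₄_subset_J₀.trans (subset_zariskiClosure _)))
  rw [← p.mk_rep] at hp
  obtain ⟨a₁, a, b, c, hpr⟩ := exists_of_mem_J₀ _ hp
  rw [hpr]
  exact polyEval_eq_zero_of_join hf h (Matrix.of ![a, a₁]) (Matrix.of b) (Matrix.of c)

end TensorLoci

theorem mainTheorem6 :
    (∀ T ∈ orbit T₁₃ ∪ orbit T₁₅ ∪ orbit T₁₆ ∪ orbit T₁₇,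
      forbiddenLocus T = {p : (Fin 2 → ℂ) × (Fin 3 → ℂ) × (Fin 3 → ℂ) |
        ∀ t : ℂ, ∃ h : T - t • (p.1 ⊗ₜ[ℂ] (p.2.1 ⊗ₜ[ℂ] p.2.2)) ≠ 0,
          Projectivization.mk ℂ (T - t • (p.1 ⊗ₜ[ℂ] (p.2.1 ⊗ₜ[ℂ] p.2.2))) h ∈
            X₂₃₃Dual \ (σ₂X₂₃₃ ∪ Sub₂₃₃ 2 2 3 ∪ Sub₂₃₃ 2 3 2 ∪ J₀)}) ∧
    zariskiClosure J₀ = zariskiClosure (projectivize (orbit T₁₄)) := by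
  refine ⟨fun T hT => Set.ext fun p => ?_, zariskiClosure_J₀⟩
  rw [mem_forbiddenLocus_iff (tensorRank_eq_four hT)]
  exact forall_congr' fun t => four_le_tensorRank_iff _
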